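/- Fix $q\in(0,1)$ and $\tau_1\in(0,1)$, and let $\theta(F)=F^{-1}(q)=\inf\{x: F(x)\ge q\}$ be the $q$-th quantile functional. For each sample size $n$ put $k_1=\lfloor n\tau_1\rfloor$ and let $Y_t=Y^{(1)}_t$ for $1\le t\le k_1$ and $Y_t=Y^{(2)}_t$ for $k_1<t\le n$, where $\{Y^{(1)}_t\}_{t\in\mathbb Z}$ and $\{Y^{(2)}_t\}_{t\in\mathbb Z}$ are strictly stationary real-valued processes (which may depend on $n$) on a common probability space, with an arbitrary dependence between them. Let $F^{(i)}$ be the distribution function of $Y^{(i)}_t$, $f^{(i)}$ its density and $\theta_i=\theta(F^{(i)})$. For weights $\omega=(\omega^{(1)},\omega^{(2)})$ with $\omega^{(i)}\ge 0$, $\omega^{(1)}+\omega^{(2)}=1$ write $F^\omega=\sum_i\omega^{(i)}F^{(i)}$, $f^\omega=\sum_i\omega^{(i)}f^{(i)}$, $\theta(\omega)=\theta(F^\omega)$ and $$\xi_i(y,\omega)=\frac{F^{(i)}(\theta(\omega))-\mathbf 1(y\le\theta(\omega))}{f^\omega(\theta(\omega))},\qquad i=1,2.$$ For $1\le a\le b\le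 n$ let $\omega_{a,b}$ be the vector of the proportions of the times $t\le k_1$ and $t>k_1$ in $\{a,\dots,b\}$, let $\widehat\theta_{a,b}=\theta(\widehat F_{a,b})$ with $\widehat F_{a,b}$ the empirical distribution function of $Y_a,\dots,Y_b$, and define the remainder $r_{a,b}(\omega_{a,b})$ by $$\widehat\theta_{a,b}=\theta(\omega_{a,b})+\frac1{b-a+1}\Big[\sum_{a\le t\le b,\ t\le k_1}\xi_1(Y^{(1)}_t,\omega_{a,b})+\sum_{a\le t\le b,\ t>k_1}\xi_2(Y^{(2)}_t,\omega_{a,b})\Big]+r_{a,b}(\omega_{a,b}).$$ Assume that there are positive constants $c_0,c_1,c_2,c_3,C$ and $\lambda>4/5$, none depending on $n$, such that for every $n$: 1. the $\alpha$-mixing coefficients $\alpha(k)=\sup_{1\le j\le n-k}\ \sup\{|P(A\cap B)-P(A)P(B)|: A\in\sigma(Y_1,\dots,Y_j),\ B\in\sigma(Y_{j+k},\dots,Y_n)\}$ of the data $Y_1,\dots,Y_n$ satisfy $\alpha(k)\le\exp(-c_0k)$ for all $k\ge1$; 2. for $i=1,2$, $f^{(i)}\le c_1$ on $\mathbb R$;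 $f^{(i)}\ge c_2$ on $[\min(\theta_1,\theta_2),\max(\theta_1,\theta_2)]$; and $f^{(i)}$ is differentiable with $|f^{(i)\prime}|\le c_3$ on $\mathbb R$; 3. $P(|Y^{(i)}_t|>x)\le Cx^{-\lambda}$ for all $x>0$, $t\in\mathbb Z$ and $i=1,2$. Then $\xi_i$ is the partial influence function of the quantile functional: for every $n$, $i$ and $\omega$ and every $y\ne\theta(\omega)$, $\xi_i(y,\omega)$ is the derivative at $\zeta=0$ of $\zeta\mapsto\theta\big(F^\omega+\zeta(\delta_y-F^{(i)})\big)$, where $\delta_y(x)=\mathbf 1(y\le x)$. Moreover, as $n\to\infty$, $$\sup_{1\le k\le n}k\,|r_{1,k}(\omega_{1,k})|+\sup_{1\le k\le n}(n-k+1)\,|r_{k,n}(\omega_{k,n})|=o_p(n^{1/2}).$$ -/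

import Mathlib

open MeasureTheory ProbabilityTheory Filter Topology

namespace QuantileCP

noncomputable section

/-- The `q`-th quantile functional `F ↦ F⁻¹(q) = inf {x : F x ≥ q}`. -/
def quantileOf (q : ℝ) (F : ℝ → ℝ) : ℝ := sInf {x : ℝ | q ≤ F x}

/-- Empirical distribution function of the subsample `y a, …, y b` (for `a ≤ b`). -/
def empCDF (y : ℕ → ℝ) (a b : ℕ) (x : ℝ) : ℝ :=
  (∑ t ∈ Finset.Icc a b, if y t ≤ x then (1 : ℝ) else 0) / ((b : ℝ) - a + 1)

/-- The segment of time `t` when the change-point is `k₁`: `0` for the first segment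
(`t ≤ k₁`), `1` for the second one. -/
def segIndex (k₁ t : ℕ) : Fin 2 := if t ≤ k₁ then 0 else 1

/-- The proportions of the two segments in the subsample with times `a, …, b`. -/
def weights (k₁ a b : ℕ) : Fin 2 → ℝ :=
  if b ≤ k₁ then ![1, 0]
  else if k₁ < a then ![0, 1]
  else ![((k₁ : ℝ) - a + 1) / ((b : ℝ) - a + 1), ((b : ℝ) - k₁) / ((b : ℝ) - a + 1)]

/-- The mixture `w⁽¹⁾ g⁽¹⁾ + w⁽²⁾ g⁽²⁾` of two functions (distribution functions or densities). -/
def mixture (w : Fin 2 → ℝ) (g : Fin 2 → ℝ → ℝ) (x : ℝ) : ℝ := ∑ i, w i * g i x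

/-- `θ(w)`: the `q`-th quantile of the mixture distribution function. -/
def mixQuantile (q : ℝ) (F : Fin 2 → ℝ → ℝ) (w : Fin 2 → ℝ) : ℝ :=
  quantileOf q (mixture w F)

/-- The influence function `ξ_i(y, w)` of the `q`-th quantile at the mixture with weights `w`. -/
def influence (q : ℝ) (F f : Fin 2 → ℝ → ℝ) (w : Fin 2 → ℝ) (i : Fin 2) (y : ℝ) : ℝ :=
  (F i (mixQuantile q F w) - if y ≤ mixQuantile q F w then (1 : ℝ) else 0) /
    mixture w f (mixQuantile q F w)

/-- The remainder `r_{a,b}(ω_{a,b})` of the expansion of the sample quantile of `y a, …, y b`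
around the quantile of the mixture distribution, defined by
`θ̂_{a,b} = θ(ω_{a,b}) + (b - a + 1)⁻¹ ∑_{t=a}^b ξ_{i(t)}(y t, ω_{a,b}) + r_{a,b}(ω_{a,b})`,
where `i(t)` is the segment of `t`. -/
def remainder (q : ℝ) (F f : Fin 2 → ℝ → ℝ) (k₁ : ℕ) (y : ℕ → ℝ) (a b : ℕ) : ℝ :=
  quantileOf q (empCDF y a b) - mixQuantile q F (weights k₁ a b)
    - (∑ t ∈ Finset.Icc a b, influence q F f (weights k₁ a b) (segIndex k₁ t) (y t)) /
        ((b : ℝ) - a + 1)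

/-- `sup_{1 ≤ k ≤ n} k |r_{1,k}| + sup_{1 ≤ k ≤ n} (n - k + 1) |r_{k,n}|`. -/
def supRemainder (q : ℝ) (F f : Fin 2 → ℝ → ℝ) (k₁ n : ℕ) (y : ℕ → ℝ) : ℝ :=
  (⨆ k : Set.Icc 1 n, ((k : ℕ) : ℝ) * |remainder q F f k₁ y 1 k|) +
    ⨆ k : Set.Icc 1 n, ((n : ℝ) - ((k : ℕ) : ℝ) + 1) * |remainder q F f k₁ y k n|

variable {Ω : Type*} [MeasurableSpace Ω]

/-- The observed series: `Z 0 t` up to the change-point `k₁`, and `Z 1 t` after it. -/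
def observed (Z : Fin 2 → ℤ → Ω → ℝ) (k₁ : ℕ) (t : ℕ) (ω : Ω) : ℝ :=
  Z (segIndex k₁ t) (t : ℤ) ω

/-- Strict stationarity of a process indexed by `ℤ`: its law on `ℝ^ℤ` is shift invariant. -/
def StrictlyStationary (μ : Measure Ω) (Z : ℤ → Ω → ℝ) : Prop :=
  ∀ h : ℤ, μ.map (fun ω (t : ℤ) => Z (t + h) ω) = μ.map (fun ω (t : ℤ) => Z t ω)

/-- The marginal distribution function of a stationary process. -/
def marginalCDF (μ : Measure Ω) (Z : ℤ → Ω → ℝ) (x : ℝ) : ℝ := cdf (μ.map (Z 0)) x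

/-- `α(𝓐, 𝓑) = sup {|P(A ∩ B) - P(A) P(B)| : A ∈ 𝓐, B ∈ 𝓑}`. -/
def alphaDep {Ω : Type*} {m : MeasurableSpace Ω} (μ : Measure Ω) (𝓐 𝓑 : MeasurableSpace Ω) : ℝ :=
  sSup {x : ℝ | ∃ A B : Set Ω, MeasurableSet[𝓐] A ∧ MeasurableSet[𝓑] B ∧
    x = |μ.real (A ∩ B) - μ.real A * μ.real B|}

/-- The σ-algebra generated by `Y a, …, Y b`. -/
@[reducible] def sigmaBetween (Y : ℕ → Ω → ℝ) (a b : ℕ) : MeasurableSpace Ω :=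
  ⨆ t ∈ Finset.Icc a b, MeasurableSpace.comap (Y t) inferInstance

/-- The strong mixing coefficient at lag `k` of the finite sequence `Y 1, …, Y n`: the supremum
over `1 ≤ j ≤ n - k` of `α(σ(Y 1, …, Y j), σ(Y (j + k), …, Y n))`. -/
def alphaCoeff (μ : Measure Ω) (Y : ℕ → Ω → ℝ) (n k : ℕ) : ℝ :=
  sSup {x : ℝ | ∃ j : ℕ, 1 ≤ j ∧ j + k ≤ n ∧
    x = alphaDep μ (sigmaBetween Y 1 j) (sigmaBetween Y (j + k) n)}

end

end QuantileCP

open QuantileCP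

namespace QuantileCP

/-! ### Exponential tails for sums of weakly dependent indicators -/

section Chernoff

/-! On a window of length `m`, let `G` be the empirical distribution function, `θ` the mixture
quantile and `φ` the mixture density at `θ`. Since the mixture `F` takes the value `q` at `θ`, the
influence terms collapse and the remainder is `quantileOf q G - θ + (G θ - q) / φ` (`remainder_eq`).
This is a Bahadur remainder: it is controlled by the increments of the deviation `m (G - F)` near
`θ` and by the Taylor error of `F` (`abs_quantileOf_sub_le`).

Both the deviation at `θ` and its increments are centred visit counts of a mixing sequence. A
Chernoff bound along residue classes modulo a block length (`mixing_sum_tail_le`) gives exponential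
tails. Its exponent keeps the probability of the visited set, so increments over short intervals are
much smaller than the deviation itself. Only finitely many evaluation points occur, because `G θ` is
a multiple of `1 / m`; a union bound replaces chaining. With deviation level `m ^ (3/5)` and
increments at scale `m ^ (-2/5)`, this yields `m |r| ≤ m ^ (2/5)` outside probability `m ^ (-2)` for
large `m`, uniformly in the model (`exists_remainder_tail_le`).

For the suprema, fix a cutoff `K`. Windows longer than `K` fail with total probability of order `∑ m
^ (-2) ≤ 1 / K`, and `n ^ (2/5)` is negligible against `√n`. The boundedly many shorter windows can
only fail if some observation is of order `√n` (`short_window_tail_le`), which the tail assumption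
excludes as `n → ∞`. Finally `K` is arbitrary.

The derivative claim is a separate deterministic sandwich of the contaminated quantile
(`hasDerivAt_quantileOf_contaminated`). -/

theorem exp_le_one_add_add_sq {y : ℝ} (hy : |y| ≤ 1) : Real.exp y ≤ 1 + y + y ^ 2 := by
  have := abs_le.1 (Real.abs_exp_sub_one_sub_id_le hy)
  linarith [this.2]

/-- In the second-order bound for `exp` the linear terms cancel and the variance is at most `p`.
Keeping `p` in the exponent is what later makes rare events cheap. -/
theorem bernoulli_mgf_le {p x : ℝ} (hp0 : 0 ≤ p) (hp1 : p ≤ 1) (hx : |x| ≤ 1) :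
    p * Real.exp (x * (1 - p)) + (1 - p) * Real.exp (x * (0 - p)) ≤ Real.exp (x ^ 2 * p) := by
  have h1 : |x * (1 - p)| ≤ 1 := by
    rw [abs_mul, abs_of_nonneg (sub_nonneg.2 hp1)]
    nlinarith [abs_nonneg x]
  have h2 : |x * (0 - p)| ≤ 1 := by
    rw [abs_mul, zero_sub, abs_neg, abs_of_nonneg hp0]
    nlinarith [abs_nonneg x]
  have e1 := mul_le_mul_of_nonneg_left (exp_le_one_add_add_sq h1) hp0
  have e2 := mul_le_mul_of_nonneg_left (exp_le_one_add_add_sq h2) (sub_nonneg.2 hp1)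
  have e3 := Real.add_one_le_exp (x ^ 2 * p)
  have e4 : 0 ≤ x ^ 2 * p ^ 2 := by positivity
  nlinarith

variable {Ω : Type*} [MeasurableSpace Ω]

/-- Centred sum `σ ∑_{j < J} (1_{A j} - P(A j))` of indicators. -/
noncomputable def centredSum (μ : Measure Ω) (A : ℕ → Set Ω) (σ : ℝ) (J : ℕ) (ω : Ω) : ℝ :=
  ∑ j ∈ Finset.range J, σ * ((A j).indicator 1 ω - μ.real (A j))

/-- A Chernoff bound for weakly dependent events. -/
theorem centredSum_tail_le (μ : Measure Ω) [IsProbabilityMeasure μ] (A : ℕ → Set Ω)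
    (hA : ∀ j, MeasurableSet (A j)) {σ l α : ℝ} (hl : |l * σ| ≤ 1)
    (J : ℕ) (hα : ∀ j < J, ∀ s : ℝ,
      |μ.real ({ω | s ≤ centredSum μ A σ j ω} ∩ A j)
        - μ.real {ω | s ≤ centredSum μ A σ j ω} * μ.real (A j)| ≤ α) (hl0 : 0 ≤ l) (s : ℝ) :
    μ.real {ω | s ≤ centredSum μ A σ J ω} ≤
      Real.exp (-(l * s) + (l * σ) ^ 2 * ∑ j ∈ Finset.range J, μ.real (A j)) + J * (2 * α) := by
  -- The induction runs on the tail probability itself, for all levels `s` at once: mixing controls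
  -- events, so no covariance inequality for exponentials is needed.
  induction J generalizing s with
  | zero =>
    by_cases hs : s ≤ 0
    · have : (1 : ℝ) ≤ Real.exp (-(l * s)) := Real.one_le_exp (by nlinarith)
      simpa using measureReal_le_one.trans this
    · have : {ω : Ω | s ≤ centredSum μ A σ 0 ω} = ∅ := by
        ext ω; simpa [centredSum] using hs
      rw [this]; simp; positivity
  | succ J ih =>
    have ih' := ih (fun j hj => hα j (by omega))
    set p := μ.real (A J) with hp
    set P := ∑ j ∈ Finset.range J, μ.real (A j) with hP
    have hp0 : 0 ≤ p := measureReal_nonneg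
    have hp1 : p ≤ 1 := measureReal_le_one
    let E : ℝ → Set Ω := fun s => {ω | s ≤ centredSum μ A σ J ω}
    have hsplit : μ.real {ω | s ≤ centredSum μ A σ (J + 1) ω} ≤
        μ.real (E (s - σ * (1 - p)) ∩ A J) + μ.real (E (s - σ * (0 - p)) \ A J) := by
      refine (measureReal_mono ?_).trans (measureReal_union_le _ _)
      intro ω hω
      simp only [Set.mem_ofPred_eq, centredSum, Finset.sum_range_succ] at hω
      by_cases h : ω ∈ A J
      · left
        refine ⟨?_, h⟩
        rw [Set.indicator_of_mem h] at hω
        simp only [E, Set.mem_ofPred_eq, centredSum]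
        simp only [Pi.one_apply] at hω
        linarith
      · right
        refine ⟨?_, h⟩
        rw [Set.indicator_of_notMem h] at hω
        simp only [E, Set.mem_ofPred_eq, centredSum]
        linarith
    -- Each of the two halves is decoupled from `A J` at cost `α`, whence `2 * α` per step. The
    -- inherited errors are averaged with weights `p` and `1 - p`, so they do not grow.
    have h1 := (abs_le.1 (hα J (by omega) (s - σ * (1 - p)))).2
    have h2 := (abs_le.1 (hα J (by omega) (s - σ * (0 - p)))).1
    have hd := measureReal_inter_add_sdiff (μ := μ) (s := E (s - σ * (0 - p))) (hA J)
    have i1 := mul_le_mul_of_nonneg_right (ih' (s - σ * (1 - p))) hp0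
    have i2 := mul_le_mul_of_nonneg_right (ih' (s - σ * (0 - p))) (sub_nonneg.2 hp1)
    have key := mul_le_mul_of_nonneg_left (bernoulli_mgf_le hp0 hp1 hl)
      (Real.exp_pos (-(l * s) + (l * σ) ^ 2 * P)).le
    rw [← Real.exp_add] at key
    have k1 : Real.exp (-(l * (s - σ * (1 - p))) + (l * σ) ^ 2 * P) =
      Real.exp (-(l * s) + (l * σ) ^ 2 * P) * Real.exp (l * σ * (1 - p)) := by
      rw [← Real.exp_add]; congr 1; ring
    have k2 : Real.exp (-(l * (s - σ * (0 - p))) + (l * σ) ^ 2 * P) =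
      Real.exp (-(l * s) + (l * σ) ^ 2 * P) * Real.exp (l * σ * (0 - p)) := by
      rw [← Real.exp_add]; congr 1; ring
    rw [k1] at i1
    rw [k2] at i2
    rw [Finset.sum_range_succ, mul_add, ← add_assoc]
    push_cast
    simp only [E] at hsplit hd
    linarith

end Chernoff

/-! ### Deviation bounds for mixing sequences -/

section Mixing

variable {Ω : Type*} [MeasurableSpace Ω]

theorem abs_real_inter_sub_mul_le_one {Ω : Type*} {_ : MeasurableSpace Ω} (μ : Measure Ω) [IsProbabilityMeasure μ] (A B : Set Ω) :
    |μ.real (A ∩ B) - μ.real A * μ.real B| ≤ 1 := by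
  have h1 : 0 ≤ μ.real A * μ.real B := by positivity
  have h2 : μ.real A * μ.real B ≤ 1 :=
    mul_le_one₀ measureReal_le_one measureReal_nonneg measureReal_le_one
  have h3 : μ.real (A ∩ B) ≤ 1 := measureReal_le_one
  have h4 : 0 ≤ μ.real (A ∩ B) := measureReal_nonneg
  rw [abs_le]; constructor <;> linarith

theorem alphaCoeff_nonneg (μ : Measure Ω) (Y : ℕ → Ω → ℝ) (n k : ℕ) : 0 ≤ alphaCoeff μ Y n k := by
  refine Real.sSup_nonneg ?_
  rintro x ⟨j, -, -, rfl⟩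
  refine Real.sSup_nonneg ?_
  rintro x ⟨A, B, -, -, rfl⟩
  exact abs_nonneg _

theorem le_alphaCoeff (μ : Measure Ω) [IsProbabilityMeasure μ] (Y : ℕ → Ω → ℝ) {n k j : ℕ}
    (hj : 1 ≤ j) (hjk : j + k ≤ n) {A B : Set Ω} (hA : MeasurableSet[sigmaBetween Y 1 j] A)
    (hB : MeasurableSet[sigmaBetween Y (j + k) n] B) :
    |μ.real (A ∩ B) - μ.real A * μ.real B| ≤ alphaCoeff μ Y n k := by
  have hle : ∀ 𝓐 𝓑 : MeasurableSpace Ω, alphaDep μ 𝓐 𝓑 ≤ 1 := by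
    intro 𝓐 𝓑
    refine Real.sSup_le ?_ zero_le_one
    rintro x ⟨A, B, -, -, rfl⟩
    exact abs_real_inter_sub_mul_le_one μ A B
  refine le_trans (b := alphaDep μ (sigmaBetween Y 1 j) (sigmaBetween Y (j + k) n)) ?_ ?_
  · refine le_csSup ⟨1, ?_⟩ ⟨A, B, hA, hB, rfl⟩
    rintro x ⟨A, B, -, -, rfl⟩
    exact abs_real_inter_sub_mul_le_one μ A B
  · refine le_csSup ⟨1, ?_⟩ ⟨j, hj, hjk, rfl⟩
    rintro x ⟨j, -, -, rfl⟩
    exact hle _ _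

theorem measurable_sigmaBetween {Ω : Type*} (Y : ℕ → Ω → ℝ) {a b t : ℕ} (hat : a ≤ t) (htb : t ≤ b) :
    Measurable[sigmaBetween Y a b] (Y t) := by
  have : MeasurableSpace.comap (Y t) inferInstance ≤ sigmaBetween Y a b :=
    le_iSup₂_of_le t (Finset.mem_Icc.2 ⟨hat, htb⟩) le_rfl
  exact (comap_measurable (Y t)).mono this le_rfl

theorem measurable_sum_indicator {Ω : Type*} [MeasurableSpace Ω] {A : ℕ → Set Ω} (p : ℕ → ℝ)
    (σ : ℝ) {J : ℕ} (hA : ∀ j < J, MeasurableSet (A j)) :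
    Measurable fun ω => ∑ j ∈ Finset.range J, σ * ((A j).indicator (1 : Ω → ℝ) ω - p j) :=
  Finset.measurable_fun_sum _ fun j hj => Measurable.const_mul (Measurable.sub_const
    (measurable_one.indicator (hA j (Finset.mem_range.1 hj))) _) _

/-- Deviation of the number of visits of a mixing sequence to a set. -/
theorem mixing_sum_tail_le (μ : Measure Ω) [IsProbabilityMeasure μ] (Y : ℕ → Ω → ℝ)
    (hY : ∀ t, Measurable (Y t)) {n a m ℓ : ℕ} (ha : 1 ≤ a) (hn : a + m ≤ n + 1) (hℓ : 1 ≤ ℓ)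
    {A : Set ℝ} (hA : MeasurableSet A) {h l σ η : ℝ}
    (hh : ∀ t, μ.real (Y t ⁻¹' A) ≤ h) (hl : |l * σ| ≤ 1) (hl0 : 0 ≤ l) :
    μ.real {ω | η ≤ σ * ∑ i ∈ Finset.range m, ((Y (a + i) ⁻¹' A).indicator 1 ω
        - μ.real (Y (a + i) ⁻¹' A))} ≤
      ℓ * (Real.exp (-(l * (η / ℓ)) + (l * σ) ^ 2 * (m * h)) + m * (2 * alphaCoeff μ Y n ℓ)) := by
  classical
  have hℓ0 : (0 : ℝ) < ℓ := by exact_mod_cast hℓ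
  have hh0 : 0 ≤ h := measureReal_nonneg.trans (hh 0)
  have hα0 := alphaCoeff_nonneg μ Y n ℓ
  -- Padding with empty events lets every residue class modulo `ℓ` carry exactly `m` terms. Within a
  -- class `U r`, consecutive nonempty events are `ℓ` time steps apart.
  let V : ℕ → Set Ω := fun i => if i < m then Y (a + i) ⁻¹' A else ∅
  let U : ℕ → ℕ → Set Ω := fun r j => V (r + j * ℓ)
  have hV : ∀ i, MeasurableSet (V i) := by
    intro i
    simp only [V]; split_ifs
    exacts [hY _ hA, MeasurableSet.empty]
  have hsum : ∀ ω, σ * ∑ i ∈ Finset.range m, ((Y (a + i) ⁻¹' A).indicator 1 ω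
        - μ.real (Y (a + i) ⁻¹' A)) = ∑ r ∈ Finset.range ℓ, centredSum μ (U r) σ m ω := by
    intro ω
    let g : ℕ → ℝ := fun i => σ * ((V i).indicator 1 ω - μ.real (V i))
    have e1 : ∑ r ∈ Finset.range ℓ, centredSum μ (U r) σ m ω =
        ∑ i ∈ Finset.range (m * ℓ), g i := by
      simp only [centredSum, U]
      rw [Finset.sum_comm]
      change ∑ j ∈ Finset.range m, ∑ r ∈ Finset.range ℓ, g (r + j * ℓ) = _
      clear hn
      have : ∀ M : ℕ, ∑ j ∈ Finset.range M, ∑ r ∈ Finset.range ℓ, g (r + j * ℓ) =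
          ∑ i ∈ Finset.range (M * ℓ), g i := by
        intro M
        induction M with
        | zero => simp
        | succ M ih =>
          rw [Finset.sum_range_succ, ih, Nat.succ_mul, Finset.sum_range_add]
          congr 1
          exact Finset.sum_congr rfl fun r _ => by rw [add_comm]
      exact this m
    rw [e1, Finset.mul_sum]
    have hsub : Finset.range m ⊆ Finset.range (m * ℓ) := by
      intro i; simp only [Finset.mem_range]; intro hi; nlinarith
    rw [← Finset.sum_subset hsub]
    · refine Finset.sum_congr rfl fun i hi => ?_
      simp [g, V, Finset.mem_range.1 hi]
    · intro i _ hi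
      simp only [Finset.mem_range] at hi
      simp [g, V, hi]
  have hone : ∀ r ∈ Finset.range ℓ, μ.real {ω | η / ℓ ≤ centredSum μ (U r) σ m ω} ≤
      Real.exp (-(l * (η / ℓ)) + (l * σ) ^ 2 * (m * h)) + m * (2 * alphaCoeff μ Y n ℓ) := by
    intro r hr
    have hmain := centredSum_tail_le μ (U r) (fun j => hV _) (α := alphaCoeff μ Y n ℓ) hl m ?_ hl0
      (η / ℓ)
    · refine hmain.trans ?_
      gcongr
      calc ∑ j ∈ Finset.range m, μ.real (U r j) ≤ ∑ j ∈ Finset.range m, h := by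
            refine Finset.sum_le_sum fun j _ => ?_
            simp only [U, V]; split_ifs
            · exact hh _
            · simpa using hh0
        _ = m * h := by simp
    · intro j hj s
      by_cases hin : r + j * ℓ < m
      -- For `j = 0` there is no past: the partial sum is constant, its event is empty or full, and
      -- the covariance vanishes.
      · rcases Nat.eq_zero_or_pos j with rfl | hj0
        · by_cases hs : s ≤ 0
          · simpa [centredSum, hs] using hα0
          · simpa [centredSum, hs] using hα0
        · obtain ⟨i, rfl⟩ : ∃ i, j = i + 1 := ⟨j - 1, by omega⟩
          have hjl : (i + 1) * ℓ = i * ℓ + ℓ := by ring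
          have h1 : U r (i + 1) = Y (a + (r + i * ℓ) + ℓ) ⁻¹' A := by
            simp only [U, V, if_pos hin]
            rw [hjl]; congr 2; omega
          refine le_alphaCoeff μ Y (j := a + (r + i * ℓ)) (by omega) (by omega) ?_ ?_
          · have hmeas : Measurable[sigmaBetween Y 1 (a + (r + i * ℓ))]
                (centredSum μ (U r) σ (i + 1)) := by
              refine @measurable_sum_indicator _ (sigmaBetween Y 1 (a + (r + i * ℓ))) _ _ _ _ ?_
              intro i' hi'
              simp only [U, V]
              split_ifs with h'
              · refine measurable_sigmaBetween Y (by omega) ?_ hA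
                have : i' ≤ i := by omega
                nlinarith
              · exact @MeasurableSet.empty _ (sigmaBetween Y 1 (a + (r + i * ℓ)))
            exact hmeas measurableSet_Ici
          · rw [h1]
            exact measurable_sigmaBetween Y le_rfl (by omega) hA
      · have : U r j = ∅ := by simp [U, V, hin]
        rw [this]; simpa using hα0
  calc _ ≤ μ.real (⋃ r ∈ Finset.range ℓ, {ω | η / ℓ ≤ centredSum μ (U r) σ m ω}) := by
        refine measureReal_mono ?_ (measure_ne_top _ _)
        intro ω hω
        simp only [Set.mem_ofPred_eq, hsum ω] at hω
        have hne : (Finset.range ℓ).Nonempty := Finset.nonempty_range_iff.2 (by omega)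
        -- Pigeonhole: if the `ℓ` class sums add up to at least `η`, one of them reaches `η / ℓ`.
        obtain ⟨r, hr, hr'⟩ := Finset.exists_le_of_sum_le (f := fun _ => η / (ℓ : ℝ)) hne
          (by simpa [mul_div_cancel₀ _ hℓ0.ne'] using hω)
        simp only [Set.mem_iUnion]
        exact ⟨r, hr, hr'⟩
    _ ≤ ∑ r ∈ Finset.range ℓ, μ.real {ω | η / ℓ ≤ centredSum μ (U r) σ m ω} :=
        measureReal_biUnion_finset_le _ _
    _ ≤ _ := by
        refine (Finset.sum_le_sum hone).trans ?_
        rw [Finset.sum_const, Finset.card_range, nsmul_eq_mul]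

/-- Two-sided version of `mixing_sum_tail_le`. -/
theorem mixing_abs_sum_tail_le (μ : Measure Ω) [IsProbabilityMeasure μ] (Y : ℕ → Ω → ℝ)
    (hY : ∀ t, Measurable (Y t)) {n a m ℓ : ℕ} (ha : 1 ≤ a) (hn : a + m ≤ n + 1) (hℓ : 1 ≤ ℓ)
    {A : Set ℝ} (hA : MeasurableSet A) {h l η : ℝ}
    (hh : ∀ t, μ.real (Y t ⁻¹' A) ≤ h) (hl0 : 0 ≤ l) (hl : l ≤ 1) :
    μ.real {ω | η ≤ |∑ i ∈ Finset.range m, ((Y (a + i) ⁻¹' A).indicator 1 ω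
        - μ.real (Y (a + i) ⁻¹' A))|} ≤
      2 * (ℓ * (Real.exp (-(l * (η / ℓ)) + l ^ 2 * (m * h)) +
        m * (2 * alphaCoeff μ Y n ℓ))) := by
  have h1 := mixing_sum_tail_le μ Y hY ha hn hℓ hA (l := l) (σ := 1) (η := η) hh
    (by rwa [mul_one, abs_of_nonneg hl0]) hl0
  have h2 := mixing_sum_tail_le μ Y hY ha hn hℓ hA (l := l) (σ := -1) (η := η) hh
    (by rwa [mul_neg_one, abs_neg, abs_of_nonneg hl0]) hl0
  rw [mul_one] at h1
  rw [mul_neg_one, neg_sq] at h2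
  rw [two_mul]
  refine le_trans (le_trans (measureReal_mono ?_) (measureReal_union_le _ _)) (add_le_add h1 h2)
  intro ω hω
  rcases le_abs.1 (Set.mem_ofPred_eq ▸ hω : η ≤ |_|) with h | h
  · left; simpa using h
  · right; simpa using h

end Mixing

/-! ### Deterministic expansions of the quantile functional -/

section Quantile

theorem quantileOf_le {q x : ℝ} {F : ℝ → ℝ} (hb : BddBelow {x | q ≤ F x}) (hx : q ≤ F x) :
    quantileOf q F ≤ x := csInf_le hb hx

theorem le_quantileOf {q z : ℝ} {F : ℝ → ℝ} (hne : ∃ x, q ≤ F x) (hz : ∀ x < z, F x < q) :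
    z ≤ quantileOf q F :=
  le_csInf hne fun x hx => le_of_not_gt fun h => absurd (hz x h) (not_lt.2 hx)

theorem bddBelow_of_forall_lt {q z : ℝ} {F : ℝ → ℝ} (hz : ∀ x < z, F x < q) :
    BddBelow {x | q ≤ F x} :=
  ⟨z, fun x hx => le_of_not_gt fun h => absurd (hz x h) (not_lt.2 hx)⟩

theorem lt_of_lt_quantileOf {q x : ℝ} {F : ℝ → ℝ} (hb : BddBelow {x | q ≤ F x})
    (hx : x < quantileOf q F) : F x < q :=
  lt_of_not_ge fun h => absurd (quantileOf_le hb h) (not_le.2 hx)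

theorem apply_quantileOf {q : ℝ} {F : ℝ → ℝ} (hF : Continuous F) (hne : ∃ x, q ≤ F x)
    (hb : BddBelow {x | q ≤ F x}) : F (quantileOf q F) = q := by
  apply le_antisymm
  · have h : Tendsto F (𝓝[<] (quantileOf q F)) (𝓝 (F (quantileOf q F))) :=
      (hF.tendsto _).mono_left nhdsWithin_le_nhds
    refine le_of_tendsto h ?_
    filter_upwards [self_mem_nhdsWithin] with x hx
    exact (lt_of_lt_quantileOf hb hx).le
  · have hc : IsClosed {x | q ≤ F x} := isClosed_le continuous_const hF
    exact hc.csInf_mem hne hb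

/-- The quantile functional is differentiable along contaminations away from the quantile. -/
theorem hasDerivAt_quantileOf_contaminated {F H : ℝ → ℝ} {q θ φ c c' y : ℝ}
    (hmono : Monotone F) (hθ : quantileOf q F = θ) (hφ : 0 < φ) (hc : 0 < c) (hc' : 0 < c')
    (hF : ∀ x, |F x - q - φ * (x - θ)| ≤ c * (x - θ) ^ 2)
    (hH : ∀ x, |H x - H θ| ≤ c' * |x - θ|) (hH0 : ∀ x, 0 ≤ H x) (hH1 : ∀ x, H x ≤ 1)
    (hy : y ≠ θ) :
    HasDerivAt (fun ζ : ℝ => quantileOf q fun x => F x + ζ * ((if y ≤ x then (1 : ℝ) else 0) - H x))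
      ((H θ - if y ≤ θ then (1 : ℝ) else 0) / φ) 0 := by
  set I : ℝ := if y ≤ θ then (1 : ℝ) else 0 with hI
  set d := (H θ - I) / φ with hd
  have hdφ : φ * d = H θ - I := by rw [hd]; field_simp
  rw [hasDerivAt_iff_isLittleO, Asymptotics.isLittleO_iff]
  intro ε hε
  -- With `v = x - θ - ζ * d` and `|v| ≥ ε * |ζ|`, this constant gives `|x - θ| ≤ K * |v|`, so
  -- errors in `x - θ` become errors in `v`.
  set K := 1 + |d| / ε with hK
  have hK1 : 1 ≤ K := by rw [hK]; linarith [div_nonneg (abs_nonneg d) hε.le]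
  have hyθ : 0 < |y - θ| := abs_pos.2 (sub_ne_zero.2 hy)
  -- The first bound keeps the jump at `y` outside the `δ`-neighbourhood of `θ`; the second makes
  -- the quadratic error at most `φ / 4 * |v|`.
  set δ := min (|y - θ| / 2) (φ / (4 * c * K)) with hδ
  have hδ0 : 0 < δ := lt_min (by linarith) (by positivity)
  have hδy : δ < |y - θ| := (min_le_left _ _).trans_lt (by linarith)
  have hδK : c * δ * K ≤ φ / 4 := by
    have : δ ≤ φ / (4 * c * K) := min_le_right _ _
    rw [le_div_iff₀ (by positivity)] at this
    linarith
  have hcδ : c * δ ≤ φ / 4 := le_trans (by nlinarith [mul_pos hc hδ0]) hδK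
  have hind : ∀ x, |x - θ| ≤ δ → (if y ≤ x then (1 : ℝ) else 0) = I := by
    intro x hx
    have hx' := abs_le.1 hx
    rw [hI]
    rcases lt_abs.1 hδy with h | h
    · rw [if_neg (by linarith), if_neg (by linarith)]
    · rw [if_pos (by linarith), if_pos (by linarith)]
  set r := min (φ / (4 * c' * K)) (min (φ * δ / 2) (δ / (|d| + ε))) with hr
  have hr0 : 0 < r := by
    refine lt_min (by positivity) (lt_min (by positivity) (by positivity))
  have hev : ∀ᶠ ζ : ℝ in 𝓝 0, |ζ| < r := by
    have := Metric.ball_mem_nhds (0 : ℝ) hr0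
    filter_upwards [this] with ζ hζ
    simpa [Metric.mem_ball, Real.dist_eq] using hζ
  filter_upwards [hev] with ζ hζ
  have hζ1 : |ζ| * c' * K ≤ φ / 4 := by
    have : |ζ| ≤ φ / (4 * c' * K) := hζ.le.trans (min_le_left _ _)
    rw [le_div_iff₀ (by positivity)] at this
    linarith
  have hζ2 : |ζ| < φ * δ / 2 := hζ.trans_le ((min_le_right _ _).trans (min_le_left _ _))
  have hζ3 : |ζ| * (|d| + ε) < δ := by
    have : |ζ| < δ / (|d| + ε) := hζ.trans_le ((min_le_right _ _).trans (min_le_right _ _))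
    rwa [lt_div_iff₀ (by positivity)] at this
  rcases eq_or_ne ζ 0 with rfl | hζ0
  · simp
  have hζpos : 0 < |ζ| := abs_pos.2 hζ0
  set G : ℝ → ℝ := fun x => F x + ζ * ((if y ≤ x then (1 : ℝ) else 0) - H x) with hG
  have hG0 : (quantileOf q fun x => F x + 0 * ((if y ≤ x then (1 : ℝ) else 0) - H x)) = θ := by
    simpa using hθ
  have hζ4 : |ζ| * |d| + ε * |ζ| < δ := by linarith
  have hεζ : 0 < ε * |ζ| := by positivity
  have habs := abs_le.1 (le_refl |ζ * d|)
  rw [abs_mul] at habs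
  have hexp : ∀ x, |x - θ| ≤ δ → ε * |ζ| ≤ |x - θ - ζ * d| →
      |G x - q - φ * (x - θ - ζ * d)| ≤ φ / 2 * |x - θ - ζ * d| := by
    intro x hx hv
    set v := x - θ - ζ * d with hv'
    have hu : |x - θ| ≤ K * |v| := by
      have h1 : |x - θ| ≤ |v| + |ζ| * |d| := by
        calc |x - θ| = |v + ζ * d| := by rw [hv']; ring_nf
          _ ≤ _ := (abs_add_le _ _).trans (by rw [abs_mul])
      have h2 : |ζ| * |d| ≤ |d| / ε * |v| := by
        rw [div_mul_eq_mul_div, le_div_iff₀ hε]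
        nlinarith [abs_nonneg d]
      rw [hK]; linarith
    -- The definition of `d` cancels the first-order contamination; only the Taylor error of `F` and
    -- the increment of `H` are left.
    have hGx : G x - q - φ * v = (F x - q - φ * (x - θ)) - ζ * (H x - H θ) := by
      simp only [hG, hind x hx, hv']
      linear_combination ζ * hdφ
    rw [hGx]
    have h1 := hF x
    have h2 : c * (x - θ) ^ 2 ≤ φ / 4 * |v| := by
      rw [← sq_abs]
      calc c * |x - θ| ^ 2 = c * |x - θ| * |x - θ| := by ring
        _ ≤ c * δ * (K * |v|) := by gcongr
        _ = c * δ * K * |v| := by ring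
        _ ≤ _ := by gcongr
    have h3 : |ζ * (H x - H θ)| ≤ φ / 4 * |v| := by
      rw [abs_mul]
      calc |ζ| * |H x - H θ| ≤ |ζ| * (c' * (K * |v|)) := by
            gcongr; exact (hH x).trans (by gcongr)
        _ = |ζ| * c' * K * |v| := by ring
        _ ≤ _ := by gcongr
    calc _ ≤ |F x - q - φ * (x - θ)| + |ζ * (H x - H θ)| := abs_sub _ _
      _ ≤ _ := by linarith
  -- The contaminated function need not be monotone, so all points to the left are checked: near `θ`
  -- by the expansion, farther away by monotonicity of `F` and `|ζ| < φ * δ / 2`.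
  have hlow : ∀ x < θ + ζ * d - ε * |ζ|, G x < q := by
    intro x hx
    by_cases hxδ : |x - θ| ≤ δ
    · have hneg : x - θ - ζ * d < 0 := by linarith
      have := (abs_le.1 (hexp x hxδ (by rw [abs_of_neg hneg]; linarith))).2
      rw [abs_of_neg hneg] at this
      linarith [mul_neg_of_pos_of_neg hφ hneg]
    · have hx1 : x < θ - δ := by
        rcases lt_abs.1 (not_le.1 hxδ) with h | h
        · linarith [habs.2]
        · linarith
      have h1 : F x ≤ F (θ - δ) := hmono hx1.le
      have h2 := (abs_le.1 (hF (θ - δ))).2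
      have h3 : ζ * ((if y ≤ x then (1 : ℝ) else 0) - H x) ≤ |ζ| := by
        have : |(if y ≤ x then (1 : ℝ) else 0) - H x| ≤ 1 := by
          have := hH0 x
          have := hH1 x
          rw [abs_le]; split_ifs <;> constructor <;> linarith
        calc _ ≤ |ζ * ((if y ≤ x then (1 : ℝ) else 0) - H x)| := le_abs_self _
          _ ≤ |ζ| * 1 := by rw [abs_mul]; gcongr
          _ = _ := mul_one _
      have h4 : c * δ * δ ≤ φ / 4 * δ := by gcongr
      have h5 : F (θ - δ) - q - φ * (θ - δ - θ) = F (θ - δ) - q + φ * δ := by ring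
      have h6 : c * (θ - δ - θ) ^ 2 = c * δ * δ := by ring
      rw [h5, h6] at h2
      have h7 : 0 < φ * δ := by positivity
      simp only [hG]
      linarith
  have hup : q ≤ G (θ + ζ * d + ε * |ζ|) := by
    have hv : θ + ζ * d + ε * |ζ| - θ - ζ * d = ε * |ζ| := by ring
    have hv0 := hεζ
    have := (abs_le.1 (hexp (θ + ζ * d + ε * |ζ|) ?_ ?_)).1
    · rw [hv, abs_of_pos hv0] at this
      nlinarith
    · rw [abs_le]; constructor <;> nlinarith
    · rw [hv]; exact le_abs_self _
  have hT1 : quantileOf q G ≤ θ + ζ * d + ε * |ζ| := quantileOf_le (bddBelow_of_forall_lt hlow) hup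
  have hT2 : θ + ζ * d - ε * |ζ| ≤ quantileOf q G := le_quantileOf ⟨_, hup⟩ hlow
  rw [hG0, Real.norm_eq_abs, Real.norm_eq_abs, sub_zero, smul_eq_mul, abs_le]
  constructor <;> linarith

/-- Deterministic part of the Bahadur expansion. -/
theorem abs_quantileOf_sub_le {F G : ℝ → ℝ} {q θ φ c m η ρ κ : ℝ} (hG : Monotone G)
    (hne : ∃ x, q ≤ G x) (hb : BddBelow {x | q ≤ G x}) (hφ : 0 < φ) (hc : 0 ≤ c) (hm : 0 < m)
    (hF : ∀ x, |F x - q - φ * (x - θ)| ≤ c * (x - θ) ^ 2)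
    (hρ : |(G θ - q) / φ| + η / m ≤ ρ) (hη : 0 ≤ η)
    (hinc : ∀ s : ℝ, |s| = 1 → |m * (G (θ - (G θ - q) / φ + s * (η / m))
      - F (θ - (G θ - q) / φ + s * (η / m))) - m * (G θ - q)| ≤ κ)
    (hκ : κ + m * (c * ρ ^ 2) < φ * η) :
    m * |quantileOf q G - θ + (G θ - q) / φ| ≤ η := by
  set e := (G θ - q) / φ with he
  have heφ : φ * e = G θ - q := by rw [he]; field_simp
  have hηm : 0 ≤ η / m := by positivity
  have hηm' : m * (η / m) = η := by field_simp
  -- At the two points `θ - e ± η / m` the main term of `m (G - q)` is `± φ * η`, which dominates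
  -- the error; the signs then trap the quantile between them.
  have key : ∀ s : ℝ, |s| = 1 → |m * (G (θ - e + s * (η / m)) - q) - s * (φ * η)| < φ * η := by
    intro s hs
    set x := θ - e + s * (η / m) with hx
    have h1 := hinc s hs
    have h2 := hF x
    have hxρ : |x - θ| ≤ ρ := by
      calc |x - θ| = |-e + s * (η / m)| := by rw [hx]; ring_nf
        _ ≤ |e| + η / m := (abs_add_le _ _).trans (by rw [abs_neg, abs_mul, hs, abs_of_nonneg hηm]; linarith)
        _ ≤ ρ := hρ
    have h3 : c * (x - θ) ^ 2 ≤ c * ρ ^ 2 := by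
      rw [← sq_abs]; gcongr
    have e1 : m * (G x - q) - s * (φ * η) =
        (m * (G x - F x) - m * (G θ - q)) + m * (F x - q - φ * (x - θ)) := by
      have : x - θ = -e + s * (η / m) := by rw [hx]; ring
      rw [this]
      linear_combination (s * φ) * hηm' - m * heφ
    rw [e1]
    calc _ ≤ _ := abs_add_le _ _
      _ ≤ κ + m * (c * ρ ^ 2) := by
        rw [abs_mul, abs_of_pos hm]
        gcongr
        exact h2.trans h3
      _ < _ := hκ
  have h1 := (abs_lt.1 (key 1 (by simp))).1
  have h2 := (abs_lt.1 (key (-1) (by simp))).2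
  have u1 : quantileOf q G ≤ θ - e + 1 * (η / m) := by
    refine quantileOf_le hb ?_
    have : 0 < m * (G (θ - e + 1 * (η / m)) - q) := by linarith
    linarith [(pos_iff_pos_of_mul_pos this).1 hm]
  have u2 : θ - e + -1 * (η / m) ≤ quantileOf q G := by
    refine le_quantileOf hne fun x hx => (hG hx.le).trans_lt ?_
    have : 0 < m * (q - G (θ - e + -1 * (η / m))) := by linarith
    linarith [(pos_iff_pos_of_mul_pos this).1 hm]
  have : |quantileOf q G - θ + e| ≤ η / m := by
    rw [abs_le]; constructor <;> linarith
  calc _ ≤ m * (η / m) := by gcongr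
    _ = η := hηm'

end Quantile

/-- Distribution functions `F i` with bounded Lipschitz densities `f i` that are bounded below
between the two `q`-quantiles. -/
structure RegularPair (q c₁ c₂ c₃ : ℝ) (F f : Fin 2 → ℝ → ℝ) : Prop where
  hasDerivAt : ∀ i x, HasDerivAt (F i) (f i x) x
  mono : ∀ i, Monotone (F i)
  nonneg : ∀ i x, 0 ≤ F i x
  le_one : ∀ i x, F i x ≤ 1
  tendsto_atBot : ∀ i, Tendsto (F i) atBot (𝓝 0)
  tendsto_atTop : ∀ i, Tendsto (F i) atTop (𝓝 1)
  density_nonneg : ∀ i x, 0 ≤ f i x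
  density_le : ∀ i x, f i x ≤ c₁
  density_lipschitz : ∀ i x y, |f i x - f i y| ≤ c₃ * |x - y|
  le_density : ∀ i, ∀ x ∈ Set.uIcc (quantileOf q (F 0)) (quantileOf q (F 1)), c₂ ≤ f i x

/-! ### Mixtures of two regular distribution functions -/

namespace RegularPair

variable {q c₁ c₂ c₃ : ℝ} {F f : Fin 2 → ℝ → ℝ} {w : Fin 2 → ℝ}

theorem continuous (h : RegularPair q c₁ c₂ c₃ F f) (i : Fin 2) : Continuous (F i) :=
  continuous_iff_continuousAt.2 fun x => (h.hasDerivAt i x).continuousAt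

theorem bddBelow (h : RegularPair q c₁ c₂ c₃ F f) (hq0 : 0 < q) (i : Fin 2) :
    BddBelow {x | q ≤ F i x} := by
  obtain ⟨z, hz⟩ := ((h.tendsto_atBot i).eventually (eventually_lt_nhds hq0)).exists
  exact bddBelow_of_forall_lt fun x hx => (h.mono i hx.le).trans_lt hz

theorem exists_le (h : RegularPair q c₁ c₂ c₃ F f) (hq1 : q < 1) (i : Fin 2) :
    ∃ x, q ≤ F i x := by
  obtain ⟨z, hz⟩ := ((h.tendsto_atTop i).eventually (eventually_gt_nhds hq1)).exists
  exact ⟨z, hz.le⟩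

theorem hasDerivAt_mixture (h : RegularPair q c₁ c₂ c₃ F f) (w : Fin 2 → ℝ) (x : ℝ) :
    HasDerivAt (mixture w F) (mixture w f x) x :=
  HasDerivAt.fun_sum fun i _ => (h.hasDerivAt i x).const_mul (w i)

theorem continuous_mixture (h : RegularPair q c₁ c₂ c₃ F f) (w : Fin 2 → ℝ) :
    Continuous (mixture w F) :=
  continuous_iff_continuousAt.2 fun x => (h.hasDerivAt_mixture w x).continuousAt

theorem mixture_mono (h : RegularPair q c₁ c₂ c₃ F f) (hw : ∀ j, 0 ≤ w j) :
    Monotone (mixture w F) := fun _ _ hxy =>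
  Finset.sum_le_sum fun i _ => mul_le_mul_of_nonneg_left (h.mono i hxy) (hw i)

theorem le_mixture {g : Fin 2 → ℝ → ℝ} {c x : ℝ} (hw : ∀ j, 0 ≤ w j) (hw1 : ∑ j, w j = 1)
    (hc : ∀ i, c ≤ g i x) : c ≤ mixture w g x := by
  calc c = ∑ j, w j * c := by rw [← Finset.sum_mul, hw1, one_mul]
    _ ≤ _ := Finset.sum_le_sum fun i _ => mul_le_mul_of_nonneg_left (hc i) (hw i)

theorem mixture_le {g : Fin 2 → ℝ → ℝ} {c x : ℝ} (hw : ∀ j, 0 ≤ w j) (hw1 : ∑ j, w j = 1)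
    (hc : ∀ i, g i x ≤ c) : mixture w g x ≤ c := by
  calc _ ≤ ∑ j, w j * c :=
        Finset.sum_le_sum fun i _ => mul_le_mul_of_nonneg_left (hc i) (hw i)
    _ = c := by rw [← Finset.sum_mul, hw1, one_mul]

/-- One weight may vanish, so the terms need not be strictly ordered; comparing with the larger of
the two values avoids a case split. -/
theorem mixture_lt {g : Fin 2 → ℝ → ℝ} {c x : ℝ} (hw : ∀ j, 0 ≤ w j) (hw1 : ∑ j, w j = 1)
    (hc : ∀ i, g i x < c) : mixture w g x < c := by
  have h : mixture w g x ≤ max (g 0 x) (g 1 x) := by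
    refine mixture_le hw hw1 fun i => ?_
    fin_cases i
    exacts [le_max_left _ _, le_max_right _ _]
  exact h.trans_lt (max_lt (hc 0) (hc 1))

theorem lt_of_lt_min (h : RegularPair q c₁ c₂ c₃ F f) (hq0 : 0 < q) {x : ℝ}
    (hx : x < min (quantileOf q (F 0)) (quantileOf q (F 1))) (i : Fin 2) : F i x < q := by
  refine lt_of_lt_quantileOf (h.bddBelow hq0 i) ?_
  fin_cases i
  exacts [hx.trans_le (min_le_left _ _), hx.trans_le (min_le_right _ _)]

theorem le_apply_max (h : RegularPair q c₁ c₂ c₃ F f) (hq0 : 0 < q) (hq1 : q < 1) (i : Fin 2) :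
    q ≤ F i (max (quantileOf q (F 0)) (quantileOf q (F 1))) := by
  refine (apply_quantileOf (h.continuous i) (h.exists_le hq1 i) (h.bddBelow hq0 i)).symm.le.trans
    (h.mono i ?_)
  fin_cases i
  exacts [le_max_left _ _, le_max_right _ _]

theorem bddBelow_mixture (h : RegularPair q c₁ c₂ c₃ F f) (hq0 : 0 < q) (hw : ∀ j, 0 ≤ w j)
    (hw1 : ∑ j, w j = 1) : BddBelow {x | q ≤ mixture w F x} :=
  bddBelow_of_forall_lt fun _ hx => mixture_lt hw hw1 (h.lt_of_lt_min hq0 hx)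

/-- Both components are below `q` left of the smaller quantile and at least `q` at the larger one,
and averages inherit this. It places every mixture quantile where the densities are at least `c₂`.
-/
theorem mixQuantile_mem (h : RegularPair q c₁ c₂ c₃ F f) (hq0 : 0 < q) (hq1 : q < 1)
    (hw : ∀ j, 0 ≤ w j) (hw1 : ∑ j, w j = 1) :
    mixQuantile q F w ∈ Set.uIcc (quantileOf q (F 0)) (quantileOf q (F 1)) := by
  have hmax := le_mixture hw hw1 (h.le_apply_max hq0 hq1)
  exact ⟨le_quantileOf ⟨_, hmax⟩ fun _ hx => mixture_lt hw hw1 (h.lt_of_lt_min hq0 hx),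
    quantileOf_le (h.bddBelow_mixture hq0 hw hw1) hmax⟩

theorem mixture_mixQuantile (h : RegularPair q c₁ c₂ c₃ F f) (hq0 : 0 < q) (hq1 : q < 1)
    (hw : ∀ j, 0 ≤ w j) (hw1 : ∑ j, w j = 1) : mixture w F (mixQuantile q F w) = q :=
  apply_quantileOf (h.continuous_mixture w) ⟨_, le_mixture hw hw1 (h.le_apply_max hq0 hq1)⟩
    (h.bddBelow_mixture hq0 hw hw1)

theorem le_mixture_density (h : RegularPair q c₁ c₂ c₃ F f) (hq0 : 0 < q) (hq1 : q < 1)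
    (hw : ∀ j, 0 ≤ w j) (hw1 : ∑ j, w j = 1) : c₂ ≤ mixture w f (mixQuantile q F w) :=
  le_mixture hw hw1 fun i => h.le_density i _ (h.mixQuantile_mem hq0 hq1 hw hw1)

theorem mixture_density_lipschitz (h : RegularPair q c₁ c₂ c₃ F f)
    (hw : ∀ j, 0 ≤ w j) (hw1 : ∑ j, w j = 1) (x y : ℝ) :
    |mixture w f x - mixture w f y| ≤ c₃ * |x - y| := by
  have : mixture w f x - mixture w f y = mixture w (fun i _ => f i x - f i y) 0 := by
    simp only [mixture, ← Finset.sum_sub_distrib, mul_sub]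
  rw [this, abs_le]
  exact ⟨le_mixture hw hw1 fun i => (abs_le.1 (h.density_lipschitz i x y)).1,
    mixture_le hw hw1 fun i => (abs_le.1 (h.density_lipschitz i x y)).2⟩

theorem abs_sub_le (h : RegularPair q c₁ c₂ c₃ F f) (i : Fin 2) (x y : ℝ) :
    |F i x - F i y| ≤ c₁ * |x - y| := by
  refine convex_univ.norm_image_sub_le_of_norm_hasDerivWithin_le (f := F i) (f' := f i)
    (fun z _ => (h.hasDerivAt i z).hasDerivWithinAt) (fun z _ => ?_) (Set.mem_univ y)
    (Set.mem_univ x)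
  rw [Real.norm_eq_abs, abs_of_nonneg (h.density_nonneg i z)]
  exact h.density_le i z

/-- Mean value inequality for the mixture minus its linear part: between `θ` and `x` the derivative
is at most `c₃ * |x - θ|`. -/
theorem taylor (h : RegularPair q c₁ c₂ c₃ F f) (hq0 : 0 < q) (hq1 : q < 1) (hc₃ : 0 < c₃)
    (hw : ∀ j, 0 ≤ w j) (hw1 : ∑ j, w j = 1) (x : ℝ) :
    |mixture w F x - q - mixture w f (mixQuantile q F w) * (x - mixQuantile q F w)| ≤
      c₃ * (x - mixQuantile q F w) ^ 2 := by
  set θ := mixQuantile q F w with hθ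
  have key := (convex_uIcc θ x).norm_image_sub_le_of_norm_hasDerivWithin_le
    (f := fun z => mixture w F z - mixture w f θ * z) (f' := fun z => mixture w f z - mixture w f θ)
    (C := c₃ * |x - θ|) (fun z _ => by
      simpa using ((h.hasDerivAt_mixture w z).fun_sub
        ((hasDerivAt_id z).const_mul (mixture w f θ))).hasDerivWithinAt)
    (fun z hz => by
      refine (h.mixture_density_lipschitz hw hw1 z θ).trans ?_
      exact mul_le_mul_of_nonneg_left (Set.abs_sub_left_of_mem_uIcc hz) hc₃.le) Set.left_mem_uIcc Set.right_mem_uIcc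
  have e : mixture w F x - q - mixture w f θ * (x - θ) =
      (mixture w F x - mixture w f θ * x) - (mixture w F θ - mixture w f θ * θ) := by
    rw [hθ, h.mixture_mixQuantile hq0 hq1 hw hw1]; ring
  rw [e, ← sq_abs (x - θ), sq, ← mul_assoc]
  exact key

theorem abs_influence_le (h : RegularPair q c₁ c₂ c₃ F f) (hq0 : 0 < q) (hq1 : q < 1)
    (hc₂ : 0 < c₂) (hw : ∀ j, 0 ≤ w j) (hw1 : ∑ j, w j = 1) (i : Fin 2) (y : ℝ) :
    |influence q F f w i y| ≤ 1 / c₂ := by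
  have h1 := h.le_mixture_density hq0 hq1 hw hw1
  rw [influence, abs_div, abs_of_pos (hc₂.trans_le h1)]
  refine div_le_div₀ zero_le_one ?_ hc₂ h1
  have := h.nonneg i (mixQuantile q F w)
  have := h.le_one i (mixQuantile q F w)
  rw [abs_le]; split_ifs <;> constructor <;> linarith

theorem hasDerivAt_contaminated (h : RegularPair q c₁ c₂ c₃ F f) (hq0 : 0 < q) (hq1 : q < 1)
    (hc₁ : 0 < c₁) (hc₂ : 0 < c₂) (hc₃ : 0 < c₃) (hw : ∀ j, 0 ≤ w j) (hw1 : ∑ j, w j = 1)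
    (i : Fin 2) {y : ℝ} (hy : y ≠ mixQuantile q F w) :
    HasDerivAt (fun ζ : ℝ => quantileOf q (fun x => mixture w F x +
      ζ * ((if y ≤ x then (1 : ℝ) else 0) - F i x))) (influence q F f w i y) 0 :=
  hasDerivAt_quantileOf_contaminated (h.mixture_mono hw) rfl
    (hc₂.trans_le (h.le_mixture_density hq0 hq1 hw hw1)) hc₃ hc₁ (h.taylor hq0 hq1 hc₃ hw hw1)
    (fun x => h.abs_sub_le i x _) (h.nonneg i) (h.le_one i) hy

end RegularPair

/-! ### Segment proportions -/

section Weights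

theorem weights_nonneg {k₁ a b : ℕ} (hab : a ≤ b) (i : Fin 2) : 0 ≤ weights k₁ a b i := by
  have h0 : (a : ℝ) ≤ b := by exact_mod_cast hab
  unfold weights
  split_ifs with h1 h2
  · fin_cases i <;> simp
  · fin_cases i <;> simp
  · have h1' : (k₁ : ℝ) < b := by exact_mod_cast not_le.1 h1
    have h2' : (a : ℝ) ≤ k₁ := by exact_mod_cast not_lt.1 h2
    fin_cases i
    · exact div_nonneg (by linarith) (by linarith)
    · exact div_nonneg (by linarith) (by linarith)

theorem sum_segIndex {k₁ a b : ℕ} (hab : a ≤ b) (g : Fin 2 → ℝ) :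
    ∑ t ∈ Finset.Icc a b, g (segIndex k₁ t) = ((b : ℝ) - a + 1) * ∑ i, weights k₁ a b i * g i := by
  have h0 : (a : ℝ) ≤ b := by exact_mod_cast hab
  have hm : (b : ℝ) - a + 1 ≠ 0 := by linarith
  have hcard : ((b + 1 - a : ℕ) : ℝ) = (b : ℝ) - a + 1 := by
    rw [Nat.cast_sub (by omega)]; push_cast; ring
  unfold weights
  split_ifs with h1 h2
  · rw [Finset.sum_congr rfl (g := fun _ => g 0)]
    · simp [hcard]
    · intro t ht
      rw [segIndex, if_pos ((Finset.mem_Icc.1 ht).2.trans h1)]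
  · rw [Finset.sum_congr rfl (g := fun _ => g 1)]
    · simp [hcard]
    · intro t ht
      have := (Finset.mem_Icc.1 ht).1
      rw [segIndex, if_neg (by omega)]
  · have hsplit : Finset.Icc a b = Finset.Icc a k₁ ∪ Finset.Icc (k₁ + 1) b := by
      ext t; simp only [Finset.mem_union, Finset.mem_Icc]; omega
    have hdisj : Disjoint (Finset.Icc a k₁) (Finset.Icc (k₁ + 1) b) := by
      rw [Finset.disjoint_left]; intro t; simp only [Finset.mem_Icc]; omega
    rw [hsplit, Finset.sum_union hdisj, Finset.sum_congr rfl (g := fun _ => g 0),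
      Finset.sum_congr (s₁ := Finset.Icc (k₁ + 1) b) rfl (g := fun _ => g 1)]
    · have c1 : ((k₁ + 1 - a : ℕ) : ℝ) = (k₁ : ℝ) - a + 1 := by
        rw [Nat.cast_sub (by omega)]; push_cast; ring
      have c2 : ((b - k₁ : ℕ) : ℝ) = (b : ℝ) - k₁ := by
        rw [Nat.cast_sub (by omega)]
      simp [c1, c2]
      field_simp
    · intro t ht
      have := (Finset.mem_Icc.1 ht).1
      rw [segIndex, if_neg (by omega)]
    · intro t ht
      rw [segIndex, if_pos (Finset.mem_Icc.1 ht).2]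

theorem sum_weights {k₁ a b : ℕ} (hab : a ≤ b) : ∑ i, weights k₁ a b i = 1 := by
  have h0 : (a : ℝ) ≤ b := by exact_mod_cast hab
  have h := sum_segIndex (k₁ := k₁) hab (fun _ => 1)
  have hcard : ((b + 1 - a : ℕ) : ℝ) = (b : ℝ) - a + 1 := by
    rw [Nat.cast_sub (by omega)]; push_cast; ring
  simp only [Finset.sum_const, Nat.card_Icc, nsmul_eq_mul, mul_one, hcard] at h
  exact (mul_left_cancel₀ (show (b : ℝ) - a + 1 ≠ 0 by linarith) (by rw [mul_one]; exact h)).symm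

end Weights

/-! ### Regularity of the marginal distribution functions -/

section Marginal

variable {Ω : Type*} [MeasurableSpace Ω]

theorem StrictlyStationary.map_eq {μ : Measure Ω} {Z : ℤ → Ω → ℝ} (h : StrictlyStationary μ Z)
    (hZ : ∀ t, Measurable (Z t)) (t : ℤ) : μ.map (Z t) = μ.map (Z 0) := by
  have h1 := congrArg (Measure.map fun g : ℤ → ℝ => g 0) (h t)
  rw [Measure.map_map (measurable_pi_apply 0) (measurable_pi_lambda _ fun s => hZ _),
    Measure.map_map (measurable_pi_apply 0) (measurable_pi_lambda _ fun s => hZ _)] at h1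
  have e : ((fun g : ℤ → ℝ => g 0) ∘ fun ω s => Z (s + t) ω) = Z t := by
    funext ω; simp
  rw [e] at h1
  exact h1

theorem hasDerivAt_cdf_of_withDensity (ν : Measure ℝ) [IsProbabilityMeasure ν] {f : ℝ → ℝ}
    (hf0 : ∀ x, 0 ≤ f x) (hfc : Continuous f)
    (hν : ν = volume.withDensity fun x => ENNReal.ofReal (f x)) (x : ℝ) :
    HasDerivAt (fun x => cdf ν x) (f x) x := by
  have hIoc : ∀ u v : ℝ, u ≤ v → cdf ν v - cdf ν u = ∫ z in u..v, f z := by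
    intro u v huv
    have h1 : cdf ν v - cdf ν u = ν.real (Set.Ioc u v) := by
      rw [cdf_eq_real, cdf_eq_real, ← Set.Iic_sdiff_Iic,
        measureReal_sdiff (Set.Iic_subset_Iic.2 huv) measurableSet_Iic]
    rw [h1, intervalIntegral.integral_of_le huv, measureReal_def, hν,
      withDensity_apply _ measurableSet_Ioc,
      ← integral_eq_lintegral_of_nonneg_ae (ae_of_all _ hf0) hfc.aestronglyMeasurable.restrict]
  have hint : ∀ v, cdf ν v = cdf ν x + ∫ z in x..v, f z := by
    intro v
    rcases le_total x v with h | h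
    · linarith [hIoc x v h]
    · rw [intervalIntegral.integral_symm]; linarith [hIoc v x h]
  have h2 : HasDerivAt (fun v => cdf ν x + ∫ z in x..v, f z) (f x) x :=
    (intervalIntegral.integral_hasDerivAt_right (hfc.intervalIntegrable _ _)
      hfc.stronglyMeasurable.stronglyMeasurableAtFilter hfc.continuousAt).const_add _
  exact h2.congr_of_eventuallyEq (Eventually.of_forall hint)

theorem regularPair_marginalCDF (μ : Measure Ω) [IsProbabilityMeasure μ] {q c₁ c₂ c₃ : ℝ}
    {Z : Fin 2 → ℤ → Ω → ℝ} (hZ : ∀ i t, Measurable (Z i t)) {f : Fin 2 → ℝ → ℝ}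
    (hf0 : ∀ i x, 0 ≤ f i x)
    (hf : ∀ i, μ.map (Z i 0) = volume.withDensity (fun x => ENNReal.ofReal (f i x)))
    (hf1 : ∀ i x, f i x ≤ c₁)
    (hf2 : ∀ i, ∀ x ∈ Set.uIcc (quantileOf q (marginalCDF μ (Z 0)))
      (quantileOf q (marginalCDF μ (Z 1))), c₂ ≤ f i x)
    (hfd : ∀ i, Differentiable ℝ (f i)) (hf3 : ∀ i x, |deriv (f i) x| ≤ c₃) :
    RegularPair q c₁ c₂ c₃ (fun j => marginalCDF μ (Z j)) f := by
  have hp : ∀ i, IsProbabilityMeasure (μ.map (Z i 0)) := fun i =>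
    Measure.isProbabilityMeasure_map (hZ i 0).aemeasurable
  refine ⟨fun i x => ?_, fun i => monotone_cdf _, fun i x => cdf_nonneg _ x,
    fun i x => cdf_le_one _ x, fun i => tendsto_cdf_atBot _, fun i => tendsto_cdf_atTop _, hf0,
    hf1, fun i x y => ?_, hf2⟩
  · exact hasDerivAt_cdf_of_withDensity _ (hf0 i) (hfd i).continuous (hf i) x
  · exact convex_univ.norm_image_sub_le_of_norm_deriv_le (fun z _ => hfd i z)
      (fun z _ => hf3 i z) (Set.mem_univ y) (Set.mem_univ x)

end Marginal

/-! ### Empirical distribution functions and the form of the remainder -/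

section Empirical

variable {y : ℕ → ℝ} {a b : ℕ}

theorem window_length_pos (hab : a ≤ b) : (0 : ℝ) < (b : ℝ) - a + 1 := by
  have h0 : (a : ℝ) ≤ b := by exact_mod_cast hab
  linarith

theorem window_length_cast (hab : a ≤ b) : ((b + 1 - a : ℕ) : ℝ) = (b : ℝ) - a + 1 := by
  rw [Nat.cast_sub (by omega)]; push_cast; ring

theorem empCDF_mono (hab : a ≤ b) : Monotone (empCDF y a b) := by
  intro u v huv
  refine div_le_div_of_nonneg_right (Finset.sum_le_sum fun t _ => ?_) (window_length_pos hab).le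
  split_ifs with h1 h2 h2
  exacts [le_rfl, absurd (h1.trans huv) h2, zero_le_one, le_rfl]

theorem empCDF_eq_zero {x : ℝ} (h : ∀ t ∈ Finset.Icc a b, x < y t) : empCDF y a b x = 0 := by
  rw [empCDF, Finset.sum_eq_zero, zero_div]
  intro t ht
  rw [if_neg (not_le.2 (h t ht))]

theorem empCDF_eq_one (hab : a ≤ b) {x : ℝ} (h : ∀ t ∈ Finset.Icc a b, y t ≤ x) :
    empCDF y a b x = 1 := by
  rw [empCDF, Finset.sum_congr rfl (g := fun _ => (1 : ℝ)) fun t ht => if_pos (h t ht)]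
  rw [Finset.sum_const, Nat.card_Icc, nsmul_eq_mul, mul_one, window_length_cast hab,
    div_self (window_length_pos hab).ne']

theorem empCDF_bounds {q R : ℝ} (hab : a ≤ b) (hq0 : 0 < q) (hq1 : q < 1)
    (hR : ∀ t ∈ Finset.Icc a b, |y t| ≤ R) :
    q ≤ empCDF y a b R ∧ ∀ x < -R, empCDF y a b x < q := by
  refine ⟨?_, fun x hx => ?_⟩
  · rw [empCDF_eq_one hab fun t ht => (abs_le.1 (hR t ht)).2]; exact hq1.le
  · rw [empCDF_eq_zero fun t ht => hx.trans_le (abs_le.1 (hR t ht)).1]; exact hq0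

theorem abs_sampleQuantile_le {q R : ℝ} (hab : a ≤ b) (hq0 : 0 < q) (hq1 : q < 1)
    (hR : ∀ t ∈ Finset.Icc a b, |y t| ≤ R) : |quantileOf q (empCDF y a b)| ≤ R := by
  obtain ⟨h1, h2⟩ := empCDF_bounds hab hq0 hq1 hR
  exact abs_le.2 ⟨le_quantileOf ⟨_, h1⟩ h2, quantileOf_le (bddBelow_of_forall_lt h2) h1⟩

/-- `∑_{t=a}^b (1(y t ≤ x) - F_{i(t)}(x))`. -/
noncomputable def deviation (F : Fin 2 → ℝ → ℝ) (k₁ : ℕ) (y : ℕ → ℝ) (a b : ℕ) (x : ℝ) : ℝ :=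
  ∑ t ∈ Finset.Icc a b, ((if y t ≤ x then (1 : ℝ) else 0) - F (segIndex k₁ t) x)

theorem deviation_eq (F : Fin 2 → ℝ → ℝ) (k₁ : ℕ) (hab : a ≤ b) (x : ℝ) :
    deviation F k₁ y a b x =
      ((b : ℝ) - a + 1) * (empCDF y a b x - mixture (weights k₁ a b) F x) := by
  rw [deviation, Finset.sum_sub_distrib, sum_segIndex hab (fun i => F i x), mul_sub, empCDF,
    mul_div_cancel₀ _ (window_length_pos hab).ne']
  rfl

variable {q c₁ c₂ c₃ : ℝ} {F f : Fin 2 → ℝ → ℝ}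

theorem remainder_eq (h : RegularPair q c₁ c₂ c₃ F f) (hq0 : 0 < q) (hq1 : q < 1)
    (k₁ : ℕ) (hab : a ≤ b) :
    remainder q F f k₁ y a b = quantileOf q (empCDF y a b) - mixQuantile q F (weights k₁ a b) +
      (empCDF y a b (mixQuantile q F (weights k₁ a b)) - q) /
        mixture (weights k₁ a b) f (mixQuantile q F (weights k₁ a b)) := by
  have hm := (window_length_pos hab).ne'
  have h1 := deviation_eq (y := y) F k₁ hab (mixQuantile q F (weights k₁ a b))
  rw [h.mixture_mixQuantile hq0 hq1 (weights_nonneg hab) (sum_weights hab)] at h1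
  have h2 : ∑ t ∈ Finset.Icc a b, influence q F f (weights k₁ a b) (segIndex k₁ t) (y t) =
      -(deviation F k₁ y a b (mixQuantile q F (weights k₁ a b)) /
        mixture (weights k₁ a b) f (mixQuantile q F (weights k₁ a b))) := by
    rw [deviation, Finset.sum_div, ← Finset.sum_neg_distrib]
    refine Finset.sum_congr rfl fun t _ => ?_
    rw [influence, ← neg_div, neg_sub]
  rw [remainder, h2, h1, mul_div_assoc, neg_div, mul_div_cancel_left₀ _ hm, sub_neg_eq_add]

/-- A crude bound without probability: the sample quantile lies within the range of the data and the
averaged influence is at most `1 / c₂`. It serves windows too short for concentration. -/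
theorem abs_remainder_le (h : RegularPair q c₁ c₂ c₃ F f) (hq0 : 0 < q) (hq1 : q < 1)
    (hc₂ : 0 < c₂) (k₁ : ℕ) (hab : a ≤ b) {R B : ℝ} (hR : ∀ t ∈ Finset.Icc a b, |y t| ≤ R)
    (hB : ∀ i, |quantileOf q (F i)| ≤ B) : |remainder q F f k₁ y a b| ≤ R + B + 1 / c₂ := by
  have hm := window_length_pos hab
  have h1 := abs_sampleQuantile_le hab hq0 hq1 hR
  have hmem := h.mixQuantile_mem hq0 hq1 (weights_nonneg (k₁ := k₁) hab) (sum_weights hab)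
  have h2 : |mixQuantile q F (weights k₁ a b)| ≤ B := by
    have b0 := abs_le.1 (hB 0)
    have b1 := abs_le.1 (hB 1)
    exact abs_le.2 ⟨(le_min b0.1 b1.1).trans hmem.1, hmem.2.trans (max_le b0.2 b1.2)⟩
  have h3 : |(∑ t ∈ Finset.Icc a b, influence q F f (weights k₁ a b) (segIndex k₁ t) (y t)) /
      ((b : ℝ) - a + 1)| ≤ 1 / c₂ := by
    rw [abs_div, abs_of_pos hm, div_le_iff₀ hm]
    refine (Finset.abs_sum_le_sum_abs _ _).trans ?_
    refine (Finset.sum_le_sum fun t _ => h.abs_influence_le hq0 hq1 hc₂ (weights_nonneg hab)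
      (sum_weights hab) _ _).trans ?_
    rw [Finset.sum_const, Nat.card_Icc, nsmul_eq_mul, window_length_cast hab, mul_comm]
  rw [remainder]
  refine (abs_sub _ _).trans ?_
  linarith [abs_sub (quantileOf q (empCDF y a b)) (mixQuantile q F (weights k₁ a b))]

end Empirical

/-! ### Probabilistic bound for a single window -/

section Window

variable {Ω : Type*} [MeasurableSpace Ω] {μ : Measure Ω} [IsProbabilityMeasure μ]
  {Y : ℕ → Ω → ℝ} {F f : Fin 2 → ℝ → ℝ} {q c₁ c₂ c₃ : ℝ} {k₁ n a b : ℕ}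

theorem real_preimage_Ioc (hY : ∀ t, Measurable (Y t))
    (hF : ∀ t x, μ.real (Y t ⁻¹' Set.Iic x) = F (segIndex k₁ t) x) (t : ℕ) {u v : ℝ}
    (huv : u ≤ v) :
    μ.real (Y t ⁻¹' Set.Ioc u v) = F (segIndex k₁ t) v - F (segIndex k₁ t) u := by
  rw [← Set.Iic_sdiff_Iic, Set.preimage_sdiff,
    measureReal_sdiff (Set.preimage_mono (Set.Iic_subset_Iic.2 huv)) (hY t measurableSet_Iic),
    hF, hF]

theorem sum_Icc_eq_sum_range (g : ℕ → ℝ) (a b : ℕ) :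
    ∑ t ∈ Finset.Icc a b, g t = ∑ i ∈ Finset.range (b + 1 - a), g (a + i) := by
  rw [← Finset.sum_Ico_eq_sum_range g a (b + 1)]
  rfl

theorem deviation_tail_le (hY : ∀ t, Measurable (Y t))
    (hF : ∀ t x, μ.real (Y t ⁻¹' Set.Iic x) = F (segIndex k₁ t) x)
    (ha : 1 ≤ a) (hab : a ≤ b) (hbn : b ≤ n) {ℓ : ℕ} (hℓ : 1 ≤ ℓ) {l η : ℝ} (hl0 : 0 ≤ l)
    (hl1 : l ≤ 1) (x : ℝ) :
    μ.real {ω | η ≤ |deviation F k₁ (fun t => Y t ω) a b x|} ≤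
      2 * (ℓ * (Real.exp (-(l * (η / ℓ)) + l ^ 2 * ((b : ℝ) - a + 1)) +
        ((b : ℝ) - a + 1) * (2 * alphaCoeff μ Y n ℓ))) := by
  have h := mixing_abs_sum_tail_le μ Y hY (n := n) (a := a) (m := b + 1 - a) ha (by omega) hℓ
    (measurableSet_Iic (a := x)) (h := 1) (η := η) (fun t => measureReal_le_one) hl0 hl1
  rw [window_length_cast hab, mul_one] at h
  have e : ∀ ω, deviation F k₁ (fun t => Y t ω) a b x = ∑ i ∈ Finset.range (b + 1 - a),
      ((Y (a + i) ⁻¹' Set.Iic x).indicator 1 ω - μ.real (Y (a + i) ⁻¹' Set.Iic x)) := by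
    intro ω
    rw [deviation, sum_Icc_eq_sum_range]
    refine Finset.sum_congr rfl fun i _ => ?_
    rw [hF]
    simp [Set.indicator]
  simpa only [e] using h

theorem deviation_sub (hY : ∀ t, Measurable (Y t))
    (hF : ∀ t x, μ.real (Y t ⁻¹' Set.Iic x) = F (segIndex k₁ t) x) {u v : ℝ} (huv : u ≤ v)
    (ω : Ω) :
    deviation F k₁ (fun t => Y t ω) a b v - deviation F k₁ (fun t => Y t ω) a b u =
      ∑ i ∈ Finset.range (b + 1 - a), ((Y (a + i) ⁻¹' Set.Ioc u v).indicator 1 ω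
        - μ.real (Y (a + i) ⁻¹' Set.Ioc u v)) := by
  rw [deviation, deviation, ← Finset.sum_sub_distrib, sum_Icc_eq_sum_range]
  refine Finset.sum_congr rfl fun i _ => ?_
  rw [real_preimage_Ioc hY hF _ huv]
  have : (Y (a + i) ⁻¹' Set.Ioc u v).indicator (1 : Ω → ℝ) ω =
      (if Y (a + i) ω ≤ v then 1 else 0) - (if Y (a + i) ω ≤ u then 1 else 0) := by
    simp only [Set.indicator, Set.mem_preimage, Set.mem_Ioc, Pi.one_apply]
    by_cases h1 : Y (a + i) ω ≤ u
    · simp [h1, not_lt.2 h1, h1.trans huv]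
    · simp [h1, not_le.1 h1]
  rw [this]
  ring

/-- The increment is a centred count of visits to an interval of probability at most `c₁ * ρ`, and
this small factor enters the exponent. -/
theorem deviation_increment_tail_le (hY : ∀ t, Measurable (Y t))
    (hF : ∀ t x, μ.real (Y t ⁻¹' Set.Iic x) = F (segIndex k₁ t) x)
    (hR : RegularPair q c₁ c₂ c₃ F f) (hc₁ : 0 < c₁)
    (ha : 1 ≤ a) (hab : a ≤ b) (hbn : b ≤ n) {ℓ : ℕ} (hℓ : 1 ≤ ℓ) {l η ρ : ℝ} (hl0 : 0 ≤ l)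
    (hl1 : l ≤ 1) {x z : ℝ} (hxz : |x - z| ≤ ρ) :
    μ.real {ω | η ≤ |deviation F k₁ (fun t => Y t ω) a b x -
        deviation F k₁ (fun t => Y t ω) a b z|} ≤
      2 * (ℓ * (Real.exp (-(l * (η / ℓ)) + l ^ 2 * (((b : ℝ) - a + 1) * (c₁ * ρ))) +
        ((b : ℝ) - a + 1) * (2 * alphaCoeff μ Y n ℓ))) := by
  wlog hle : z ≤ x generalizing x z
  · have := this (x := z) (z := x) (by rwa [abs_sub_comm]) (le_of_not_ge hle)
    simpa only [abs_sub_comm] using this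
  have h := mixing_abs_sum_tail_le μ Y hY (n := n) (a := a) (m := b + 1 - a) ha (by omega) hℓ
    (measurableSet_Ioc (a := z) (b := x)) (h := c₁ * ρ) (η := η) (fun t => by
      rw [real_preimage_Ioc hY hF t hle]
      refine (le_abs_self _).trans ((hR.abs_sub_le _ x z).trans ?_)
      gcongr) hl0 hl1
  rw [window_length_cast hab] at h
  simpa only [deviation_sub hY hF hle] using h

/-- The Bahadur remainder of one window is small outside an event of small probability. -/
theorem remainder_tail_le (hY : ∀ t, Measurable (Y t))
    (hF : ∀ t x, μ.real (Y t ⁻¹' Set.Iic x) = F (segIndex k₁ t) x)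
    (hR : RegularPair q c₁ c₂ c₃ F f) (hq0 : 0 < q) (hq1 : q < 1) (hc₁ : 0 < c₁) (hc₂ : 0 < c₂)
    (hc₃ : 0 < c₃) (ha : 1 ≤ a) (hab : a ≤ b) (hbn : b ≤ n) {ℓ : ℕ} (hℓ : 1 ≤ ℓ)
    {l₀ l₁ η ρ κ M m : ℝ} (hm : m = (b : ℝ) - a + 1) (hl₀ : 0 ≤ l₀) (hl₀' : l₀ ≤ 1)
    (hl₁ : 0 ≤ l₁) (hl₁' : l₁ ≤ 1) (hη : 0 ≤ η) (hρ : M / (m * c₂) + η / m ≤ ρ)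
    (hκ : κ + m * (c₃ * ρ ^ 2) < c₂ * η) (hρ0 : 0 ≤ ρ) :
    μ.real {ω | η < m * |remainder q F f k₁ (fun t => Y t ω) a b|} ≤
      2 * (ℓ * (Real.exp (-(l₀ * (M / ℓ)) + l₀ ^ 2 * m) + m * (2 * alphaCoeff μ Y n ℓ))) +
      (m + 1) * (2 * (2 * (ℓ * (Real.exp (-(l₁ * (κ / ℓ)) + l₁ ^ 2 * (m * (c₁ * ρ))) +
        m * (2 * alphaCoeff μ Y n ℓ))))) := by
  classical
  have hm0 : 0 < m := hm ▸ window_length_pos hab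
  set w := weights k₁ a b with hw
  have hw0 : ∀ j, 0 ≤ w j := weights_nonneg hab
  have hw1 : ∑ j, w j = 1 := sum_weights hab
  set θ := mixQuantile q F w with hθ
  set φ := mixture w f θ with hφ
  have hφ2 : c₂ ≤ φ := hR.le_mixture_density hq0 hq1 hw0 hw1
  have hφ0 : 0 < φ := hc₂.trans_le hφ2
  set D : Ω → ℝ → ℝ := fun ω => deviation F k₁ (fun t => Y t ω) a b with hD
  -- These are all possible evaluation points `θ - (G θ - q) / φ ± η / m`, with `N` standing for the
  -- count `m * G θ`; they are nonrandom.
  set x : ℕ → ℝ → ℝ := fun N s => θ - (N / m - q) / φ + s * (η / m) with hx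
  -- Points farther than `ρ` from `θ` are discarded: they are not reached when `|D ω θ| < M`.
  set S : ℝ → ℕ → Set Ω := fun s N =>
    if |x N s - θ| ≤ ρ then {ω | κ ≤ |D ω (x N s) - D ω θ|} else ∅ with hS
  set p₁ := 2 * (ℓ * (Real.exp (-(l₁ * (κ / ℓ)) + l₁ ^ 2 * (m * (c₁ * ρ))) +
        m * (2 * alphaCoeff μ Y n ℓ))) with hp₁
  have hp₁0 : 0 ≤ p₁ := by
    have := deviation_increment_tail_le (μ := μ) hY hF hR hc₁ ha hab hbn hℓ (η := κ) hl₁ hl₁'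
      (x := θ) (z := θ) (ρ := ρ) (by simpa using hρ0)
    rw [← hm] at this
    exact measureReal_nonneg.trans this
  have hSle : ∀ s N, μ.real (S s N) ≤ p₁ := by
    intro s N
    simp only [hS]
    split_ifs with h
    · have := deviation_increment_tail_le (μ := μ) hY hF hR hc₁ ha hab hbn hℓ (η := κ) hl₁ hl₁' h
      rwa [← hm] at this
    · simpa using hp₁0
  have hsub : {ω | η < m * |remainder q F f k₁ (fun t => Y t ω) a b|} ⊆
      {ω | M ≤ |D ω θ|} ∪ ⋃ N ∈ Finset.range (b + 1 - a + 1), (S 1 N ∪ S (-1) N) := by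
    intro ω hω
    by_contra hcon
    rw [Set.mem_union, not_or] at hcon
    obtain ⟨hM, hN⟩ := hcon
    replace hM : |D ω θ| < M := not_le.1 hM
    simp only [Set.mem_iUnion, not_exists] at hN
    set G := empCDF (fun t => Y t ω) a b with hG
    have hDx : ∀ z, D ω z = m * (G z - mixture w F z) := by
      intro z; rw [hm]; exact deviation_eq F k₁ hab z
    have hDθ : D ω θ = m * (G θ - q) := by
      rw [hDx, hR.mixture_mixQuantile hq0 hq1 hw0 hw1]
    obtain ⟨N, hNm, hNG⟩ : ∃ N : ℕ, N ≤ b + 1 - a ∧ G θ = N / m := by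
      refine ⟨((Finset.Icc a b).filter fun t => Y t ω ≤ θ).card, ?_, ?_⟩
      · refine (Finset.card_filter_le _ _).trans ?_
        rw [Nat.card_Icc]
      · rw [hG, empCDF, Finset.sum_boole, hm]
    -- Any bound on the data will do; it only shows that the set defining the sample quantile is
    -- nonempty and bounded below.
    have hbd := empCDF_bounds (y := fun t => Y t ω) (R := ∑ t ∈ Finset.Icc a b, |Y t ω|)
      hab hq0 hq1 fun t ht =>
      Finset.single_le_sum (f := fun t => |Y t ω|) (fun i _ => abs_nonneg _) ht
    have hρ' : |(G θ - q) / φ| + η / m ≤ ρ := by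
      refine le_trans ?_ hρ
      gcongr
      have e : (G θ - q) / φ = D ω θ / (m * φ) := by
        rw [hDθ]; field_simp
      have hM0 : 0 ≤ M := (abs_nonneg _).trans hM.le
      rw [e, abs_div, abs_of_pos (mul_pos hm0 hφ0)]
      gcongr
    have hfin := abs_quantileOf_sub_le (F := mixture w F) (G := G) (θ := θ) (q := q) (φ := φ)
      (κ := κ) (empCDF_mono hab) ⟨_, hbd.1⟩ (bddBelow_of_forall_lt hbd.2) hφ0 hc₃.le hm0
      (hR.taylor hq0 hq1 hc₃ hw0 hw1) hρ' hη ?_ (hκ.trans_le (by gcongr))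
    · have : η < m * |remainder q F f k₁ (fun t => Y t ω) a b| := hω
      rw [remainder_eq hR hq0 hq1 k₁ hab] at this
      exact absurd hfin (not_le.2 this)
    · intro s hs
      rw [hNG]
      change |m * (G (x N s) - mixture w F (x N s)) - _| ≤ κ
      rw [← hDx, ← hNG, ← hDθ]
      have hxs : |x N s - θ| ≤ ρ := by
        refine le_trans ?_ hρ'
        have e : x N s - θ = -((G θ - q) / φ) + s * (η / m) := by
          simp only [hx]; rw [hNG]; ring
        rw [e]
        refine (abs_add_le _ _).trans ?_
        rw [abs_neg, abs_mul, hs, one_mul, abs_of_nonneg (div_nonneg hη hm0.le)]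
      have hNS := hN N (Finset.mem_range.2 (by omega))
      rw [Set.mem_union, not_or] at hNS
      have hnot : ω ∉ S s N := by
        rcases eq_or_eq_neg_of_abs_eq hs with rfl | rfl
        exacts [hNS.1, hNS.2]
      simp only [hS, if_pos hxs] at hnot
      exact (not_le.1 hnot).le
  refine (measureReal_mono hsub (measure_ne_top _ _)).trans ((measureReal_union_le _ _).trans ?_)
  refine add_le_add ?_ ?_
  · have := deviation_tail_le (μ := μ) hY hF ha hab hbn hℓ (η := M) hl₀ hl₀' θ
    rwa [← hm] at this
  · refine (measureReal_biUnion_finset_le _ _).trans ?_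
    refine (Finset.sum_le_sum fun N _ => (measureReal_union_le _ _).trans
      (add_le_add (hSle 1 N) (hSle (-1) N))).trans ?_
    rw [Finset.sum_const, Finset.card_range, nsmul_eq_mul, Nat.cast_add, window_length_cast hab,
      ← hm, Nat.cast_one, two_mul p₁]

end Window

/-! ### Choice of scales -/

section Rates

/-- Tail bound for the remainder of a window of length `s ^ 20`. -/
noncomputable def bahadurBound (c₀ c₁ c₂ s : ℝ) : ℝ :=
  2 * ((2 * s) * (Real.exp (-(s / 2) + 1) + s ^ 20 * (2 * Real.exp (-(c₀ * s))))) +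
    (s ^ 20 + 1) * (2 * (2 * ((2 * s) * (Real.exp (-(c₂ / 4 * s) + c₁ * (1 / c₂ + 1)) +
      s ^ 20 * (2 * Real.exp (-(c₀ * s)))))))

theorem tendsto_pow_mul_exp_neg_mul (k : ℕ) {c : ℝ} (hc : 0 < c) :
    Tendsto (fun s : ℝ => s ^ k * Real.exp (-(c * s))) atTop (𝓝 0) := by
  have := tendsto_rpow_mul_exp_neg_mul_atTop_nhds_zero k c hc
  simpa only [Real.rpow_natCast, neg_mul] using this

theorem tendsto_bahadurBound_mul {c₀ c₂ : ℝ} (c₁ : ℝ) (hc₀ : 0 < c₀) (hc₂ : 0 < c₂) :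
    Tendsto (fun s : ℝ => bahadurBound c₀ c₁ c₂ s * s ^ 40) atTop (𝓝 0) := by
  have h0 := fun k => tendsto_pow_mul_exp_neg_mul k hc₀
  have h1 := fun k => tendsto_pow_mul_exp_neg_mul k (c := 1 / 2) (by norm_num)
  have h2 := fun k => tendsto_pow_mul_exp_neg_mul k (c := c₂ / 4) (by linarith)
  have h := ((((h1 41).const_mul (4 * Real.exp 1)).add ((h0 61).const_mul 24)).add
    (((h2 61).add (h2 41)).const_mul (8 * Real.exp (c₁ * (1 / c₂ + 1))))).add
    ((h0 81).const_mul 16)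
  simp only [mul_zero, add_zero] at h
  refine h.congr fun s => ?_
  rw [bahadurBound, Real.exp_add, Real.exp_add, show -(s / 2) = -(1 / 2 * s) by ring]
  ring

variable {Ω : Type*} [MeasurableSpace Ω] {μ : Measure Ω} [IsProbabilityMeasure μ]
  {Y : ℕ → Ω → ℝ} {F f : Fin 2 → ℝ → ℝ} {q c₀ c₁ c₂ c₃ : ℝ} {k₁ n a b : ℕ}

theorem remainder_tail_le_bahadurBound (hY : ∀ t, Measurable (Y t))
    (hF : ∀ t x, μ.real (Y t ⁻¹' Set.Iic x) = F (segIndex k₁ t) x)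
    (hR : RegularPair q c₁ c₂ c₃ F f) (hq0 : 0 < q) (hq1 : q < 1) (hc₀ : 0 < c₀) (hc₁ : 0 < c₁)
    (hc₂ : 0 < c₂) (hc₃ : 0 < c₃)
    (hmix : ∀ k : ℕ, 1 ≤ k → alphaCoeff μ Y n k ≤ Real.exp (-(c₀ * k)))
    (ha : 1 ≤ a) (hab : a ≤ b) (hbn : b ≤ n) {s : ℝ} (hs : 1 ≤ s)
    (hsm : s ^ 20 = (b : ℝ) - a + 1) (hs4 : 2 * c₃ * (1 / c₂ + 1) ^ 2 < c₂ * s ^ 4) :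
    μ.real {ω | s ^ 8 < ((b : ℝ) - a + 1) * |remainder q F f k₁ (fun t => Y t ω) a b|} ≤
      bahadurBound c₀ c₁ c₂ s := by
  have hs0 : 0 < s := by linarith
  have hℓ1 : 1 ≤ ⌈s⌉₊ := Nat.one_le_ceil_iff.2 hs0
  have hsℓ : s ≤ ⌈s⌉₊ := Nat.le_ceil s
  have hℓ0 : (0 : ℝ) < ⌈s⌉₊ := hs0.trans_le hsℓ
  have hℓs : (⌈s⌉₊ : ℝ) ≤ 2 * s := by linarith [Nat.ceil_lt_add_one hs0.le]
  have hα : alphaCoeff μ Y n ⌈s⌉₊ ≤ Real.exp (-(c₀ * s)) := by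
    refine (hmix _ hℓ1).trans (Real.exp_le_exp.2 ?_)
    have := mul_le_mul_of_nonneg_left hsℓ hc₀.le
    linarith
  -- With `s = m ^ (1/20)`: block length about `s`, deviation level `s ^ 12`, localisation `s ^
  -- (-8)`, target `s ^ 8`. The values of `l₀` and `l₁` keep the quadratic exponents bounded, while
  -- the linear ones are at least multiples of `s`. The Taylor error is of order `s ^ 4`.
  have hmain := remainder_tail_le (μ := μ) (ℓ := ⌈s⌉₊) (l₀ := (s ^ 10)⁻¹) (l₁ := (s ^ 6)⁻¹)
    (η := s ^ 8) (ρ := (1 / c₂ + 1) / s ^ 8) (κ := c₂ * s ^ 8 / 2) (M := s ^ 12)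
    hY hF hR hq0 hq1 hc₁ hc₂ hc₃ ha hab hbn hℓ1 hsm (by positivity)
    (inv_le_one_of_one_le₀ (one_le_pow₀ hs)) (by positivity)
    (inv_le_one_of_one_le₀ (one_le_pow₀ hs)) (by positivity) ?_ ?_ (by positivity)
  · rw [← hsm]
    refine hmain.trans ?_
    have e1 : s / 2 ≤ (s ^ 10)⁻¹ * (s ^ 12 / ⌈s⌉₊) := by
      have : (s ^ 10)⁻¹ * (s ^ 12 / ⌈s⌉₊) = s ^ 2 / ⌈s⌉₊ := by field_simp
      rw [this, le_div_iff₀ hℓ0]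
      nlinarith
    have e2 : ((s ^ 10)⁻¹) ^ 2 * s ^ 20 = 1 := by field_simp
    have e3 : c₂ / 4 * s ≤ (s ^ 6)⁻¹ * (c₂ * s ^ 8 / 2 / ⌈s⌉₊) := by
      have : (s ^ 6)⁻¹ * (c₂ * s ^ 8 / 2 / ⌈s⌉₊) = c₂ * s ^ 2 / 2 / ⌈s⌉₊ := by field_simp
      rw [this, le_div_iff₀ hℓ0]
      have := mul_le_mul_of_nonneg_left hℓs (show 0 ≤ c₂ / 4 * s by positivity)
      linarith
    have e4 : ((s ^ 6)⁻¹) ^ 2 * (s ^ 20 * (c₁ * ((1 / c₂ + 1) / s ^ 8))) =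
        c₁ * (1 / c₂ + 1) := by field_simp
    have hα0 := alphaCoeff_nonneg μ Y n ⌈s⌉₊
    rw [e2, e4, bahadurBound]
    gcongr
  · have e1 : s ^ 12 / (s ^ 20 * c₂) = 1 / c₂ / s ^ 8 := by field_simp
    have e2 : s ^ 8 / s ^ 20 ≤ 1 / s ^ 8 := by
      rw [div_le_div_iff₀ (by positivity) (by positivity), ← pow_add, one_mul]
      exact pow_le_pow_right₀ hs (by norm_num)
    rw [e1, add_div]
    linarith
  · have e1 : s ^ 20 * (c₃ * ((1 / c₂ + 1) / s ^ 8) ^ 2) =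
        c₃ * (1 / c₂ + 1) ^ 2 * s ^ 4 := by field_simp
    rw [e1]
    have := mul_lt_mul_of_pos_right hs4 (show 0 < s ^ 4 by positivity)
    have e2 : c₂ * s ^ 4 * s ^ 4 = c₂ * s ^ 8 := by ring
    linarith

/-- Uniformly in the model, the remainder of a window of length `m` exceeds `m ^ (2 / 5)` with
probability at most `m ^ (-2)` for large `m`. -/
theorem exists_remainder_tail_le (hc₀ : 0 < c₀) (hc₁ : 0 < c₁) (hc₂ : 0 < c₂) (hc₃ : 0 < c₃)
    (hq0 : 0 < q) (hq1 : q < 1) (μ : Measure Ω) [IsProbabilityMeasure μ] :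
    ∃ K₀ : ℕ, ∀ (Y : ℕ → Ω → ℝ) (F f : Fin 2 → ℝ → ℝ) (k₁ n a b : ℕ), (∀ t, Measurable (Y t)) →
      (∀ t x, μ.real (Y t ⁻¹' Set.Iic x) = F (segIndex k₁ t) x) → RegularPair q c₁ c₂ c₃ F f →
      (∀ k : ℕ, 1 ≤ k → alphaCoeff μ Y n k ≤ Real.exp (-(c₀ * k))) →
      1 ≤ a → a ≤ b → b ≤ n → ∀ m : ℕ, (m : ℝ) = (b : ℝ) - a + 1 → K₀ ≤ m →
      μ.real {ω | (m : ℝ) ^ (2 / 5 : ℝ) <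
        ((b : ℝ) - a + 1) * |remainder q F f k₁ (fun t => Y t ω) a b|} ≤ ((m : ℝ) ^ 2)⁻¹ := by
  have hlim : Tendsto (fun m : ℕ => (m : ℝ) ^ (1 / 20 : ℝ)) atTop atTop :=
    (tendsto_rpow_atTop (by norm_num)).comp tendsto_natCast_atTop_atTop
  have h4 : Tendsto (fun s : ℝ => c₂ * s ^ 4) atTop atTop :=
    (tendsto_pow_atTop (by norm_num)).const_mul_atTop hc₂
  -- The factor `s ^ 40` is `m ^ 2`, so a product at most `1` is the bound `m ^ (-2)`. The threshold
  -- depends on the constants alone, not on the model.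
  have hev := hlim.eventually ((((tendsto_bahadurBound_mul c₁ hc₀ hc₂).eventually
    (eventually_le_nhds zero_lt_one)).and (eventually_ge_atTop 1)).and
    (h4.eventually (eventually_gt_atTop (2 * c₃ * (1 / c₂ + 1) ^ 2))))
  obtain ⟨K₀, hK₀⟩ := eventually_atTop.1 hev
  refine ⟨K₀, fun Y F f k₁ n a b hY hF hR hmix ha hab hbn m hm hK => ?_⟩
  obtain ⟨⟨h1, h2⟩, h3⟩ := hK₀ m hK
  set s := (m : ℝ) ^ (1 / 20 : ℝ) with hs
  have hpow : ∀ k : ℕ, s ^ k = (m : ℝ) ^ ((k : ℝ) / 20) := by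
    intro k
    rw [hs, ← Real.rpow_natCast, ← Real.rpow_mul (Nat.cast_nonneg _)]
    congr 1; ring
  have h20 : s ^ 20 = (m : ℝ) := by rw [hpow]; norm_num
  have h8 : (m : ℝ) ^ (2 / 5 : ℝ) = s ^ 8 := by rw [hpow]; norm_num
  rw [h8]
  refine (remainder_tail_le_bahadurBound hY hF hR hq0 hq1 hc₀ hc₁ hc₂ hc₃ hmix ha hab hbn h2
    (h20.trans hm) h3).trans ?_
  have h40 : s ^ 40 = (m : ℝ) ^ 2 := by rw [← h20]; ring
  rw [← h40, ← one_div, le_div_iff₀ (by positivity)]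
  exact h1

end Rates

/-! ### The observed series and the union over windows -/

section Observed

variable {Ω : Type*} [MeasurableSpace Ω] {μ : Measure Ω} [IsProbabilityMeasure μ]

theorem real_observed_preimage_Iic {Z : Fin 2 → ℤ → Ω → ℝ} (hZ : ∀ i t, Measurable (Z i t))
    (hstat : ∀ i, StrictlyStationary μ (Z i)) (k₁ t : ℕ) (x : ℝ) :
    μ.real (observed Z k₁ t ⁻¹' Set.Iic x) = marginalCDF μ (Z (segIndex k₁ t)) x := by
  have : IsProbabilityMeasure (μ.map (Z (segIndex k₁ t) 0)) :=
    Measure.isProbabilityMeasure_map (hZ _ 0).aemeasurable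
  rw [marginalCDF, cdf_eq_real, ← (hstat _).map_eq (hZ _) t,
    map_measureReal_apply (hZ _ _) measurableSet_Iic]
  rfl

/-- If the mass outside `[-B, B]` is below both `q` and `1 - q`, the quantile cannot escape. The
uniform tails thus provide one `B` for all sample sizes. -/
theorem abs_quantileOf_marginalCDF_le {Z : ℤ → Ω → ℝ} (hZ : Measurable (Z 0)) {q B : ℝ}
    (h0 : μ.real {ω | B < |Z 0 ω|} < q) (h1 : μ.real {ω | B < |Z 0 ω|} < 1 - q) :
    |quantileOf q (marginalCDF μ Z)| ≤ B := by
  have hp : IsProbabilityMeasure (μ.map (Z 0)) := Measure.isProbabilityMeasure_map hZ.aemeasurable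
  have hF : ∀ x, marginalCDF μ Z x = μ.real (Z 0 ⁻¹' Set.Iic x) := fun x => by
    rw [marginalCDF, cdf_eq_real, map_measureReal_apply hZ measurableSet_Iic]
  have hlow : ∀ x < -B, marginalCDF μ Z x < q := by
    intro x hx
    rw [hF]
    refine (measureReal_mono ?_).trans_lt h0
    intro ω hω
    have : Z 0 ω ≤ x := hω
    have h : B < |Z 0 ω| := lt_abs.2 (Or.inr (by linarith))
    exact h
  have hup : q ≤ marginalCDF μ Z B := by
    have h2 : μ.real (Z 0 ⁻¹' Set.Iic B)ᶜ ≤ μ.real {ω | B < |Z 0 ω|} := by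
      refine measureReal_mono ?_
      intro ω hω
      have : B < Z 0 ω := not_le.1 hω
      exact lt_abs.2 (Or.inl this)
    rw [probReal_compl_eq_one_sub (hZ measurableSet_Iic)] at h2
    rw [hF]
    linarith
  exact abs_le.2 ⟨le_quantileOf ⟨_, hup⟩ hlow, quantileOf_le (bddBelow_of_forall_lt hlow) hup⟩

/-- A large remainder on a short window forces a large observation. -/
theorem short_window_tail_le {Y : ℕ → Ω → ℝ} {F f : Fin 2 → ℝ → ℝ} {q c₁ c₂ c₃ : ℝ}
    {k₁ a b : ℕ} (h : RegularPair q c₁ c₂ c₃ F f) (hq0 : 0 < q) (hq1 : q < 1) (hc₂ : 0 < c₂)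
    (hab : a ≤ b) {B R K p : ℝ} (hB : ∀ i, |quantileOf q (F i)| ≤ B)
    (hK : (b : ℝ) - a + 1 ≤ K) (hp : ∀ t, μ.real {ω | R < |Y t ω|} ≤ p) :
    μ.real {ω | K * (R + B + 1 / c₂) <
      ((b : ℝ) - a + 1) * |remainder q F f k₁ (fun t => Y t ω) a b|} ≤ K * p := by
  have hp0 : 0 ≤ p := measureReal_nonneg.trans (hp 0)
  have hB0 : 0 ≤ B := (abs_nonneg _).trans (hB 0)
  have hm := window_length_pos hab
  have hsub : {ω | K * (R + B + 1 / c₂) <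
      ((b : ℝ) - a + 1) * |remainder q F f k₁ (fun t => Y t ω) a b|} ⊆
      ⋃ t ∈ Finset.Icc a b, {ω | R < |Y t ω|} := by
    intro ω hω
    by_contra hcon
    simp only [Set.mem_iUnion, not_exists] at hcon
    have h1 := abs_remainder_le (y := fun t => Y t ω) h hq0 hq1 hc₂ k₁ hab
      (fun t ht => not_lt.1 (hcon t ht)) hB
    refine absurd (show K * (R + B + 1 / c₂) < _ from hω) (not_lt.2 ?_)
    exact mul_le_mul hK h1 (abs_nonneg _) (hm.le.trans hK)
  refine (measureReal_mono hsub (measure_ne_top _ _)).trans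
    ((measureReal_biUnion_finset_le _ _).trans ((Finset.sum_le_sum fun t _ => hp t).trans ?_))
  rw [Finset.sum_const, Nat.card_Icc, nsmul_eq_mul, window_length_cast hab]
  gcongr

theorem supRemainder_nonneg (q : ℝ) (F f : Fin 2 → ℝ → ℝ) (k₁ n : ℕ) (y : ℕ → ℝ) :
    0 ≤ supRemainder q F f k₁ n y := by
  refine add_nonneg (Real.iSup_nonneg fun k => by positivity) (Real.iSup_nonneg fun k => ?_)
  have : ((k : ℕ) : ℝ) ≤ n := by exact_mod_cast k.2.2
  exact mul_nonneg (by linarith) (abs_nonneg _)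

theorem supRemainder_le {q : ℝ} {F f : Fin 2 → ℝ → ℝ} {k₁ n : ℕ} {y : ℕ → ℝ} (hn : 1 ≤ n) {e : ℝ}
    (h : ∀ a b : ℕ, 1 ≤ a → a ≤ b → b ≤ n → (a = 1 ∨ b = n) →
      ((b : ℝ) - a + 1) * |remainder q F f k₁ y a b| ≤ e) :
    supRemainder q F f k₁ n y ≤ 2 * e := by
  have : Nonempty (Set.Icc 1 n) := ⟨⟨1, le_rfl, hn⟩⟩
  rw [two_mul]
  refine add_le_add (ciSup_le fun k => ?_) (ciSup_le fun k => h k n k.2.1 k.2.2 le_rfl (Or.inr rfl))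
  simpa using h 1 k le_rfl k.2.1 k.2.2 (Or.inl rfl)

/-- Union bound over the windows entering `supRemainder`. -/
theorem supRemainder_tail_le {q : ℝ} {F f : Fin 2 → ℝ → ℝ} {k₁ n K : ℕ} {Y : ℕ → Ω → ℝ}
    (hK : 1 ≤ K) (hKn : K ≤ n) {e Q : ℝ}
    (hshort : ∀ a b : ℕ, 1 ≤ a → a ≤ b → b ≤ n → (b : ℝ) - a + 1 ≤ K →
      μ.real {ω | e < ((b : ℝ) - a + 1) * |remainder q F f k₁ (fun t => Y t ω) a b|} ≤ Q)
    (hlong : ∀ a b : ℕ, 1 ≤ a → a ≤ b → b ≤ n → ∀ m : ℕ, (m : ℝ) = (b : ℝ) - a + 1 → K < m →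
      m ≤ n →
      μ.real {ω | e < ((b : ℝ) - a + 1) * |remainder q F f k₁ (fun t => Y t ω) a b|} ≤
        ((m : ℝ) ^ 2)⁻¹) :
    μ.real {ω | 2 * e < supRemainder q F f k₁ n fun t => Y t ω} ≤ 2 * (K * Q + (K : ℝ)⁻¹) := by
  set E : ℕ → ℕ → Set Ω := fun a b =>
    {ω | e < ((b : ℝ) - a + 1) * |remainder q F f k₁ (fun t => Y t ω) a b|} with hE
  -- Prefixes and suffixes are paired by their common length `m`.
  set T : ℕ → Set Ω := fun m => E 1 m ∪ E (n + 1 - m) n with hT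
  have hsub : {ω | 2 * e < supRemainder q F f k₁ n fun t => Y t ω} ⊆
      (⋃ m ∈ Finset.Icc 1 K, T m) ∪ ⋃ m ∈ Finset.Ioc K n, T m := by
    intro ω hω
    by_contra hcon
    have hno : ∀ m, 1 ≤ m → m ≤ n → ω ∉ T m := by
      intro m hm1 hmn hmem
      refine hcon ?_
      rcases le_or_gt m K with h | h
      · exact Or.inl (Set.mem_biUnion (Finset.mem_coe.2 (Finset.mem_Icc.2 ⟨hm1, h⟩)) hmem)
      · exact Or.inr (Set.mem_biUnion (Finset.mem_coe.2 (Finset.mem_Ioc.2 ⟨h, hmn⟩)) hmem)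
    refine absurd (show 2 * e < _ from hω) (not_lt.2 (supRemainder_le (by omega) ?_))
    rintro a b ha hab hbn (rfl | rfl)
    · exact not_lt.1 fun h => hno b hab hbn (Or.inl h)
    · refine not_lt.1 fun h => hno (b + 1 - a) (by omega) (by omega) (Or.inr ?_)
      rw [show b + 1 - (b + 1 - a) = a by omega]
      exact h
  have hs : ∀ m ∈ Finset.Icc 1 K, μ.real (T m) ≤ 2 * Q := by
    intro m hm
    obtain ⟨h1, h2⟩ := Finset.mem_Icc.1 hm
    have h2' : (m : ℝ) ≤ K := by exact_mod_cast h2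
    rw [two_mul]
    refine (measureReal_union_le _ _).trans (add_le_add ?_ ?_)
    · exact hshort 1 m le_rfl h1 (by omega) (by push_cast; linarith)
    · refine hshort (n + 1 - m) n (by omega) (by omega) le_rfl ?_
      rw [Nat.cast_sub (by omega)]; push_cast; linarith
  have hl : ∀ m ∈ Finset.Ioc K n, μ.real (T m) ≤ 2 * ((m : ℝ) ^ 2)⁻¹ := by
    intro m hm
    obtain ⟨h1, h2⟩ := Finset.mem_Ioc.1 hm
    rw [two_mul]
    refine (measureReal_union_le _ _).trans (add_le_add ?_ ?_)
    · exact hlong 1 m le_rfl (by omega) h2 m (by push_cast; ring) h1 h2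
    · refine hlong (n + 1 - m) n (by omega) (by omega) le_rfl m ?_ h1 h2
      rw [Nat.cast_sub (by omega)]; push_cast; ring
  refine (measureReal_mono hsub (measure_ne_top _ _)).trans ((measureReal_union_le _ _).trans ?_)
  rw [mul_add]
  refine add_le_add ?_ ?_
  · refine (measureReal_biUnion_finset_le _ _).trans ((Finset.sum_le_sum hs).trans ?_)
    rw [Finset.sum_const, Nat.card_Icc, nsmul_eq_mul, Nat.add_sub_cancel]
    linarith
  · refine (measureReal_biUnion_finset_le _ _).trans ((Finset.sum_le_sum hl).trans ?_)
    rw [← Finset.mul_sum]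
    have := sum_Ioc_inv_sq_le_sub (α := ℝ) (k := K) (n := n) (by omega) hKn
    have h0 : (0 : ℝ) ≤ (n : ℝ)⁻¹ := by positivity
    linarith

end Observed

end QuantileCP

/-! ### The main theorem -/

theorem theoremS1 {Ω : Type*} [MeasurableSpace Ω] (μ : Measure Ω) [IsProbabilityMeasure μ]
    -- the quantile level and the relative location of the change-point
    (q : ℝ) (hq0 : 0 < q) (hq1 : q < 1)
    (τ : ℝ) (hτ0 : 0 < τ) (hτ1 : τ < 1)
    -- for each sample size `n`, the two stationary processes `Z n 0` and `Z n 1`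
    (Z : ℕ → Fin 2 → ℤ → Ω → ℝ)
    (hZ : ∀ n i t, Measurable (Z n i t))
    (hstat : ∀ n i, StrictlyStationary μ (Z n i))
    -- exponential strong mixing of the observed data
    (c₀ : ℝ) (hc₀ : 0 < c₀)
    (hmix : ∀ n k : ℕ, 1 ≤ k →
      alphaCoeff μ (observed (Z n) ⌊(n : ℝ) * τ⌋₊) n k ≤ Real.exp (-(c₀ * k)))
    -- marginal densities and their bounds
    (f : ℕ → Fin 2 → ℝ → ℝ)
    (hf0 : ∀ n i x, 0 ≤ f n i x)
    (hf : ∀ n i, μ.map (Z n i 0) = volume.withDensity (fun x => ENNReal.ofReal (f n i x)))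
    (c₁ c₂ c₃ : ℝ) (hc₁ : 0 < c₁) (hc₂ : 0 < c₂) (hc₃ : 0 < c₃)
    (hf1 : ∀ n i x, f n i x ≤ c₁)
    (hf2 : ∀ n i, ∀ x ∈ Set.uIcc (quantileOf q (marginalCDF μ (Z n 0)))
      (quantileOf q (marginalCDF μ (Z n 1))), c₂ ≤ f n i x)
    (hfd : ∀ n i, Differentiable ℝ (f n i))
    (hf3 : ∀ n i x, |deriv (f n i) x| ≤ c₃)
    -- polynomial tails
    (C lam : ℝ) (hC : 0 < C) (hlam : 4 / 5 < lam)
    (htail : ∀ n i t x, 0 < x → μ.real {ω | x < |Z n i t ω|} ≤ C * x ^ (-lam)) :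
    -- the functions `ξ_i` are the Gateaux derivatives of the quantile functional at the mixtures
    (∀ (n : ℕ) (i : Fin 2) (w : Fin 2 → ℝ), (∀ j, 0 ≤ w j) → ∑ j, w j = 1 →
      ∀ y : ℝ, y ≠ mixQuantile q (fun j => marginalCDF μ (Z n j)) w →
        HasDerivAt
          (fun ζ : ℝ => quantileOf q (fun x =>
            mixture w (fun j => marginalCDF μ (Z n j)) x +
              ζ * ((if y ≤ x then (1 : ℝ) else 0) - marginalCDF μ (Z n i) x)))
          (influence q (fun j => marginalCDF μ (Z n j)) (f n) w i y) 0) ∧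
    -- the remainder condition
    TendstoInMeasure μ
      (fun (n : ℕ) (ω : Ω) =>
        supRemainder q (fun j => marginalCDF μ (Z n j)) (f n) ⌊(n : ℝ) * τ⌋₊ n
          (fun t => observed (Z n) ⌊(n : ℝ) * τ⌋₊ t ω) / Real.sqrt n)
      atTop (fun _ => (0 : ℝ)) := by
  have hreg : ∀ n, RegularPair q c₁ c₂ c₃ (fun j => marginalCDF μ (Z n j)) (f n) := fun n =>
    regularPair_marginalCDF μ (hZ n) (hf0 n) (hf n) (hf1 n) (hf2 n) (hfd n) (hf3 n)
  refine ⟨fun n i w hw hw1 y hy =>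
    (hreg n).hasDerivAt_contaminated hq0 hq1 hc₁ hc₂ hc₃ hw hw1 i hy, ?_⟩
  have hlam0 : 0 < lam := by linarith
  have htail0 : Tendsto (fun x : ℝ => C * x ^ (-lam)) atTop (𝓝 0) := by
    simpa using (tendsto_rpow_neg_atTop hlam0).const_mul C
  obtain ⟨B, ⟨hBq, hBq'⟩, hB0⟩ := ((htail0.eventually (eventually_lt_nhds hq0)).and
    (htail0.eventually (eventually_lt_nhds (sub_pos.2 hq1)))).and (eventually_gt_atTop 0) |>.exists
  have hB : ∀ n i, |quantileOf q (marginalCDF μ (Z n i))| ≤ B := fun n i =>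
    abs_quantileOf_marginalCDF_le (hZ n i 0) ((htail n i 0 B hB0).trans_lt hBq)
      ((htail n i 0 B hB0).trans_lt hBq')
  obtain ⟨K₀, hK₀⟩ := exists_remainder_tail_le (q := q) hc₀ hc₁ hc₂ hc₃ hq0 hq1 μ
  rw [tendstoInMeasure_iff_measureReal_norm]
  intro ε hε
  have hsqrt : Tendsto (fun n : ℕ => Real.sqrt n) atTop atTop :=
    Real.tendsto_sqrt_atTop.comp tendsto_natCast_atTop_atTop
  have hrate : ∀ᶠ n : ℕ in atTop, (n : ℝ) ^ (2 / 5 : ℝ) ≤ ε * Real.sqrt n / 4 := by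
    have h10 : Tendsto (fun n : ℕ => (n : ℝ) ^ (1 / 10 : ℝ)) atTop atTop :=
      (tendsto_rpow_atTop (by norm_num)).comp tendsto_natCast_atTop_atTop
    filter_upwards [h10.eventually (eventually_ge_atTop (4 / ε)), eventually_ge_atTop 1]
      with n hn hn1
    have hn0 : (0 : ℝ) < n := by exact_mod_cast hn1
    have e : Real.sqrt n = (n : ℝ) ^ (1 / 10 : ℝ) * (n : ℝ) ^ (2 / 5 : ℝ) := by
      rw [Real.sqrt_eq_rpow, ← Real.rpow_add hn0]; norm_num
    rw [div_le_iff₀ hε] at hn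
    have h0 : 0 < (n : ℝ) ^ (2 / 5 : ℝ) := Real.rpow_pos_of_pos hn0 _
    rw [e]
    linarith [mul_le_mul_of_nonneg_right hn h0.le]
  rw [Metric.tendsto_nhds]
  intro δ hδ
  -- The cutoff is fixed before `n` grows: long windows contribute at most `2 / K < δ / 2`.
  obtain ⟨K, ⟨hKK₀, hK1⟩, hKδ⟩ := (((eventually_ge_atTop K₀).and (eventually_ge_atTop 1)).and
    (tendsto_inv_atTop_nhds_zero_nat (𝕜 := ℝ) |>.eventually
      (eventually_lt_nhds (show 0 < δ / 4 by linarith)))).exists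
  have hK0 : (0 : ℝ) < K := by exact_mod_cast hK1
  have hRlim : Tendsto (fun n : ℕ => ε * Real.sqrt n / 4 / K - (B + 1 / c₂)) atTop atTop :=
    tendsto_atTop_add_const_right _ _
      (((hsqrt.const_mul_atTop hε).atTop_div_const (by norm_num)).atTop_div_const hK0)
  -- One factor `K` counts the short lengths, the other the observations in such a window.
  have hQlim := (htail0.comp hRlim).const_mul ((K : ℝ) * K)
  rw [mul_zero] at hQlim
  filter_upwards [hrate, eventually_ge_atTop K, hRlim.eventually (eventually_gt_atTop 0),
    hQlim.eventually (eventually_lt_nhds (show 0 < δ / 4 by linarith))] with n hn hKn hR0 hQ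
  -- Solved from `K * (R + B + 1 / c₂) = ε * √n / 4`, the level at which a short window fails.
  set R := ε * Real.sqrt n / 4 / K - (B + 1 / c₂) with hR
  have hKR : K * (R + B + 1 / c₂) = ε * Real.sqrt n / 4 := by
    rw [hR]; field_simp; ring
  have hn0 : 0 < Real.sqrt n := Real.sqrt_pos.2 (by exact_mod_cast hK1.trans hKn)
  have hY : ∀ t, Measurable (observed (Z n) ⌊(n : ℝ) * τ⌋₊ t) := fun t => hZ n _ _
  have hmain := supRemainder_tail_le (μ := μ) (q := q) (F := fun j => marginalCDF μ (Z n j))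
    (f := f n) (k₁ := ⌊(n : ℝ) * τ⌋₊) (n := n) (Y := observed (Z n) ⌊(n : ℝ) * τ⌋₊)
    (e := ε * Real.sqrt n / 4) (Q := K * (C * R ^ (-lam))) hK1 hKn ?_ ?_
  · rw [Real.dist_eq, sub_zero, abs_of_nonneg measureReal_nonneg]
    refine lt_of_le_of_lt (measureReal_mono ?_ (measure_ne_top _ _)) (hmain.trans_lt ?_)
    · intro ω hω
      have h1 : ε ≤ ‖_ / Real.sqrt n - 0‖ := hω
      rw [sub_zero, Real.norm_eq_abs, abs_of_nonneg (div_nonneg (supRemainder_nonneg _ _ _ _ _ _)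
        hn0.le), le_div_iff₀ hn0] at h1
      refine lt_of_lt_of_le ?_ h1
      linarith [mul_pos hε hn0]
    · simp only [Function.comp_apply] at hQ
      linarith
  · intro a b ha hab hbn hle
    rw [← hKR]
    exact short_window_tail_le (hreg n) hq0 hq1 hc₂ hab (hB n) hle
      fun t => htail n _ _ _ hR0
  · intro a b ha hab hbn m hm hKm hmn
    refine (measureReal_mono ?_ (measure_ne_top _ _)).trans (hK₀ _ _ (f n) ⌊(n : ℝ) * τ⌋₊ n a b hY
      (fun t x => real_observed_preimage_Iic (hZ n) (hstat n) _ t x) (hreg n) (hmix n) ha hab hbn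
      m hm (hKK₀.trans hKm.le))
    intro ω hω
    have h1 : (m : ℝ) ^ (2 / 5 : ℝ) ≤ (n : ℝ) ^ (2 / 5 : ℝ) :=
      Real.rpow_le_rpow (Nat.cast_nonneg _) (by exact_mod_cast hmn) (by norm_num)
    exact (h1.trans hn).trans_lt hω
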